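/- Let $(W,\omega)$ be a symplectic manifold with concave boundary modelled on a contact manifold $(Y,\theta)$ ($\theta$ a contact form): there are $c>0$, $\epsilon>0$ and a diffeomorphism from $Y\times[c,c+\epsilon)$ onto an open neighbourhood of $\partial W$, taking $Y\times\{c\}$ onto $\partial W$ and pulling $\omega$ back to $d(\rho\,\theta)$, where $\rho\in[c,c+\epsilon)$ is the second coordinate. Use it to identify $\partial W$ with $Y$ and to regard $\rho$ and $\theta$ as defined near $Y$ in $W$. Let $\Sigma$ be a compact surface with boundary, with complex structure $j$, such that every connected component of $\Sigma$ has non-empty boundary (for instance $\Sigma$ connected and $\partial\Sigma\neq\emptyset$). Let $(J_z)_{z\in\Sigma}$ be a smooth family of $\omega$-compatible almost complex structures on $W$, and let $\mathcal K\in\Omega^1(\Sigma;C^\infty(W))$ be a (jointly smooth) one-form on $\Sigma$ with values in functions on $W$. For a function $f$ on $W$ let $X_f$ be given by $\omega(X_f,\cdot)=df$, put $\{f,g\}=\omega(X_f,X_g)$, let $X_{\mathcal K}(v)=X_{\mathcal K(v)}$ and $\{\mathcal K,\mathcal K\}(v,w)=\{\mathcal K(v),\mathcal K(w)\}$, and let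 $d_\Sigma\mathcal K$ be the exterior derivative of $\mathcal K$ in the $\Sigma$-directions. Suppose that: 1. $J_z$ is of contact type along $Y$ for all $z\in\partial\Sigma$: $d\rho\circ J_z=-\rho\,\theta$ at the points of $Y$; 2. there are one-forms $\alpha,\beta\in\Omega^1(\Sigma)$ such that $\mathcal K=\alpha\cdot\rho+\beta$ in a neighbourhood of $Y$; 3. $d_\Sigma\mathcal K-\{\mathcal K,\mathcal K\}-d\beta\ge 0$, meaning that for all $z\in\Sigma$, $v\in T_z\Sigma$ and $w\in W$, the value of this two-form on $(v,jv)$ at $w$ is non-negative. Let $u:(\Sigma,\partial\Sigma)\to(W,Y)$ be a smooth map with $(du-X_{\mathcal K})^{0,1}=0$, where $v^{0,1}=\tfrac12(v+J\circ v\circ j)$. Then the value $$[\omega;c\theta](u)=\int_\Sigma u^*\omega-\int_{\partial\Sigma}u^*(c\,\theta)$$ of the relative de Rham class $[\omega;c\theta]\in H^2(W,Y)$ on $u$ satisfies $[\omega;c\theta](u)\ge 0$, with equality if and only if $u(\Sigma)\subset Y$. -/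

import Mathlib

open scoped Manifold ContDiff Topology

noncomputable section

namespace FloerPositivity

/-! ### Differential forms on manifolds with boundary -/

section Forms

variable {E : Type*} [NormedAddCommGroup E] [NormedSpace ℝ E]
  {H : Type*} [TopologicalSpace H] (I : ModelWithCorners ℝ E H)
  (M : Type*) [TopologicalSpace M] [ChartedSpace H M]

/-- A (not necessarily smooth) differential `k`-form on `M`. -/
abbrev DForm (k : ℕ) := ∀ x : M, TangentSpace I x [⋀^Fin k]→L[ℝ] ℝ

variable {M}

/-- The derivative at `y` of the inverse of the preferred chart around `x₀`. -/
def chartSymmDeriv (x₀ : M) (y : E) : E →L[ℝ] TangentSpace I ((extChartAt I x₀).symm y) :=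
  mfderivWithin 𝓘(ℝ, E) I (extChartAt I x₀).symm (Set.range I) y

/-- The derivative at `x` of the preferred chart around `x₀`. -/
def chartDeriv (x₀ x : M) : TangentSpace I x →L[ℝ] E :=
  mfderiv I 𝓘(ℝ, E) (extChartAt I x₀) x

/-- The expression of a form in the preferred chart around `x₀`. -/
def formInChart {k : ℕ} (η : DForm I M k) (x₀ : M) (y : E) : E [⋀^Fin k]→L[ℝ] ℝ :=
  (η ((extChartAt I x₀).symm y)).compContinuousLinearMap (chartSymmDeriv I x₀ y)

/-- A form is smooth if all its expressions in charts are (up to the boundary). -/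
def SmoothForm {k : ℕ} (η : DForm I M k) : Prop :=
  ∀ x₀ : M, ContDiffOn ℝ ∞ (formInChart I η x₀) (extChartAt I x₀).target

/-- The exterior derivative, computed at `x` in the preferred chart around `x`. -/
def extD {k : ℕ} (η : DForm I M k) : DForm I M (k + 1) := fun x =>
  (extDerivWithin (formInChart I η x) (Set.range I) (extChartAt I x x)).compContinuousLinearMap
    (chartDeriv I x x)

/-- A field of endomorphisms of the tangent spaces, expressed in the preferred chart
around `x₀`. -/
def endoInChart (A : ∀ x : M, TangentSpace I x →L[ℝ] TangentSpace I x) (x₀ : M) (y : E) :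
    E →L[ℝ] E :=
  chartDeriv I x₀ ((extChartAt I x₀).symm y) ∘L A ((extChartAt I x₀).symm y) ∘L
    chartSymmDeriv I x₀ y

/-- Symplectic forms: smooth, closed and non-degenerate `2`-forms. -/
structure IsSymplectic (Ω : DForm I M 2) : Prop where
  smooth : SmoothForm I Ω
  closed : ∀ x, extD I Ω x = 0
  nondegenerate : ∀ x (v : TangentSpace I x), (∀ w : TangentSpace I x, Ω x ![v, w] = 0) → v = 0

/-- Contact forms: smooth nowhere vanishing `1`-forms `θ` such that `dθ` is non-degenerate on
`ker θ`. -/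
structure IsContactForm (θ : DForm I M 1) : Prop where
  smooth : SmoothForm I θ
  ne_zero : ∀ x, θ x ≠ 0
  nondegenerate : ∀ x (v : TangentSpace I x), θ x ![v] = 0 →
    (∀ w : TangentSpace I x, θ x ![w] = 0 → extD I θ x ![v, w] = 0) → v = 0

/-- A smooth field `j` of endomorphisms of the tangent spaces with `j² = -1`. On a surface this
is the same as a complex structure. -/
structure IsComplexStructure (j : ∀ x : M, TangentSpace I x →L[ℝ] TangentSpace I x) : Prop where
  smooth : ∀ x₀ : M, ContDiffOn ℝ ∞ (endoInChart I j x₀) (extChartAt I x₀).target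
  sq : ∀ x (v : TangentSpace I x), j x (j x v) = -v

open Classical in
/-- The vector `X` with `Ω(X, ·) = η`, where `Ω` is a form on a single tangent space. -/
def symplecticDual {x : M} (Ω : TangentSpace I x [⋀^Fin 2]→L[ℝ] ℝ)
    (η : TangentSpace I x → ℝ) : TangentSpace I x :=
  if h : ∃ X : TangentSpace I x, ∀ w : TangentSpace I x, Ω ![X, w] = η w then h.choose else 0

/-- The Hamiltonian vector field `X_f` of a function `f`, given by `Ω(X_f, ·) = df`. -/
def hamVF (Ω : DForm I M 2) (f : M → ℝ) (x : M) : TangentSpace I x :=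
  symplecticDual I (Ω x) fun v => (mfderiv I 𝓘(ℝ, ℝ) f x v : ℝ)

/-- The Poisson bracket `{f, g} = Ω(X_f, X_g)`. -/
def poisson (Ω : DForm I M 2) (f g : M → ℝ) (x : M) : ℝ :=
  Ω x ![hamVF I Ω f x, hamVF I Ω g x]

end Forms

section Pullback

variable {E : Type*} [NormedAddCommGroup E] [NormedSpace ℝ E]
  {H : Type*} [TopologicalSpace H] (I : ModelWithCorners ℝ E H)
  {M : Type*} [TopologicalSpace M] [ChartedSpace H M]
  {E' : Type*} [NormedAddCommGroup E'] [NormedSpace ℝ E']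
  {H' : Type*} [TopologicalSpace H'] (I' : ModelWithCorners ℝ E' H')
  {M' : Type*} [TopologicalSpace M'] [ChartedSpace H' M']

/-- The pullback of a form under a map. -/
def pullback {k : ℕ} (f : M → M') (η : DForm I' M' k) : DForm I M k := fun x =>
  (η (f x)).compContinuousLinearMap (mfderiv I I' f x)

/-- The pullback of a form under a map that is defined on a subset `s`. -/
def pullbackOn {k : ℕ} (s : Set M) (f : M → M') (η : DForm I' M' k) : DForm I M k := fun x =>
  (η (f x)).compContinuousLinearMap (mfderivWithin I I' f s x)

/-- A smooth family, parametrized by `z : M`, of almost complex structures on `M'` that are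
compatible with `Ω`: `Ω(·, J_z ·)` is a Riemannian metric. -/
structure IsCompatibleFamily (Ω : DForm I' M' 2)
    (J : M → ∀ w : M', TangentSpace I' w →L[ℝ] TangentSpace I' w) : Prop where
  smooth : ∀ (z₀ : M) (w₀ : M'), ContDiffOn ℝ ∞
    (fun p : E × E' => endoInChart I' (J ((extChartAt I z₀).symm p.1)) w₀ p.2)
    ((extChartAt I z₀).target ×ˢ (extChartAt I' w₀).target)
  sq : ∀ z w (v : TangentSpace I' w), J z w (J z w v) = -v
  invariant : ∀ z w (v v' : TangentSpace I' w), Ω w ![J z w v, J z w v'] = Ω w ![v, v']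
  pos : ∀ z w (v : TangentSpace I' w), v ≠ 0 → 0 < Ω w ![v, J z w v]

variable (M M') in
/-- A one-form on `M` with values in functions on `M'`: `K z w` is the covector at `z` obtained by
evaluating the function at `w`. -/
abbrev FunForm := ∀ z : M, M' → TangentSpace I z [⋀^Fin 1]→L[ℝ] ℝ

/-- Smoothness of a function-valued one-form, as a form on `M × M'`. -/
def SmoothFunForm (K : FunForm I M M') : Prop :=
  ∀ (z₀ : M) (w₀ : M'), ContDiffOn ℝ ∞
    (fun p : E × E' => formInChart I (fun z => K z ((extChartAt I' w₀).symm p.2)) z₀ p.1)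
    ((extChartAt I z₀).target ×ˢ (extChartAt I' w₀).target)

/-- The vector-field-valued one-form `X_K`: the vector `X_K(ξ)` at `w`, for `ξ` tangent at `z`. -/
def XK (Ω : DForm I' M' 2) (K : FunForm I M M') (z : M) (w : M') (ξ : TangentSpace I z) :
    TangentSpace I' w :=
  hamVF I' Ω (fun w' => K z w' ![ξ]) w

/-- The equation `(du - X_K)^{0,1} = 0`, where `v^{0,1} = (v + J ∘ v ∘ j) / 2`. -/
def SolvesCR (Ω : DForm I' M' 2) (j : ∀ z : M, TangentSpace I z →L[ℝ] TangentSpace I z)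
    (J : M → ∀ w : M', TangentSpace I' w →L[ℝ] TangentSpace I' w) (K : FunForm I M M')
    (u : M → M') : Prop :=
  ∀ (z : M) (ξ : TangentSpace I z),
    (1 / 2 : ℝ) • ((mfderiv I I' u z ξ - XK I I' Ω K z (u z) ξ) +
      J z (u z) (mfderiv I I' u z (j z ξ) - XK I I' Ω K z (u z) (j z ξ))) = 0

/-- The value at `z : M`, `w : M'` and on the pair of vectors `ξ`, `ξ'` of the function-valued
two-form `d_M K - {K, K} - dβ`. -/
def curvatureTerm (Ω : DForm I' M' 2) (K : FunForm I M M') (β : DForm I M 1) (z : M) (w : M')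
    (ξ ξ' : TangentSpace I z) : ℝ :=
  extD I (fun z' => K z' w) z ![ξ, ξ'] -
    poisson I' Ω (fun w' => K z w' ![ξ]) (fun w' => K z w' ![ξ']) w - extD I β z ![ξ, ξ']

end Pullback

/-! ### Integration on compact oriented surfaces with boundary -/

section Integration

variable {S : Type*} [TopologicalSpace S] [ChartedSpace (EuclideanHalfSpace 2) S]
  [IsManifold (𝓡∂ 2) ∞ S] [T2Space S] [CompactSpace S]

variable (S) in
/-- A smooth partition of unity subordinate to the preferred charts. -/
def chartPartition : SmoothPartitionOfUnity S (𝓡∂ 2) S Set.univ :=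
  (SmoothPartitionOfUnity.exists_isSubordinate_chartAt_source (𝓡∂ 2) S).choose

/-- `+1` or `-1` according to whether the preferred chart around `z₀` preserves or reverses
orientations at the point with coordinates `y`, the surface being oriented by the frames
`(v, j v)`. -/
def chartSign (j : ∀ z : S, TangentSpace (𝓡∂ 2) z →L[ℝ] TangentSpace (𝓡∂ 2) z) (z₀ : S)
    (y : EuclideanSpace ℝ (Fin 2)) : ℝ :=
  (SignType.sign (endoInChart (𝓡∂ 2) j z₀ y (EuclideanSpace.single 0 1) 1) : ℝ)

/-- The integral of a `2`-form over a compact surface oriented by `j`. -/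
def surfaceIntegral (j : ∀ z : S, TangentSpace (𝓡∂ 2) z →L[ℝ] TangentSpace (𝓡∂ 2) z)
    (η : DForm (𝓡∂ 2) S 2) : ℝ :=
  ∑ᶠ i : S, ∫ y in (extChartAt (𝓡∂ 2) i).target,
    chartPartition S i ((extChartAt (𝓡∂ 2) i).symm y) * (chartSign j i y *
      formInChart (𝓡∂ 2) η i y ![EuclideanSpace.single 0 1, EuclideanSpace.single 1 1])

/-- The integral of (the restriction of) a `1`-form over the boundary of a compact surface
oriented by `j`. Charts take values in the half-plane `{y | 0 ≤ y 0}`, so in an orientation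
preserving chart the boundary orientation (outward normal first) is given by `-∂/∂y₁`. -/
def boundaryIntegral (j : ∀ z : S, TangentSpace (𝓡∂ 2) z →L[ℝ] TangentSpace (𝓡∂ 2) z)
    (η : DForm (𝓡∂ 2) S 1) : ℝ :=
  ∑ᶠ i : S, ∫ t in {t : ℝ | !₂[(0 : ℝ), t] ∈ (extChartAt (𝓡∂ 2) i).target},
    chartPartition S i ((extChartAt (𝓡∂ 2) i).symm !₂[(0 : ℝ), t]) *
      (chartSign j i !₂[(0 : ℝ), t] *
        formInChart (𝓡∂ 2) η i !₂[(0 : ℝ), t] ![-EuclideanSpace.single 1 1])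

end Integration

/-! ### Concave boundaries -/

section Concave

variable {m : ℕ}
  {W : Type*} [TopologicalSpace W] [ChartedSpace (EuclideanHalfSpace (2 * m + 2)) W]
  {Y : Type*} [TopologicalSpace Y] [ChartedSpace (EuclideanSpace ℝ (Fin (2 * m + 1))) Y]

/-- The one-form `ρ θ` on `Y × ℝ`, with `ρ` the second coordinate. -/
def liouvilleForm (θ : DForm (𝓡 (2 * m + 1)) Y 1) :
    DForm ((𝓡 (2 * m + 1)).prod 𝓘(ℝ, ℝ)) (Y × ℝ) 1 := fun p =>
  p.2 • pullback ((𝓡 (2 * m + 1)).prod 𝓘(ℝ, ℝ)) (𝓡 (2 * m + 1)) Prod.fst θ p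

/-- `(W, Ω)` has concave boundary modelled on `(Y, θ)` at level `c`: a diffeomorphism from
`Y × [c, c + ε)` onto an open neighbourhood of `∂W`, taking `Y × {c}` onto `∂W` and pulling
back `Ω` to `d(ρ θ)`. -/
structure ConcaveBoundary (Ω : DForm (𝓡∂ (2 * m + 2)) W 2) (θ : DForm (𝓡 (2 * m + 1)) Y 1)
    (c : ℝ) where
  c_pos : 0 < c
  ε : ℝ
  ε_pos : 0 < ε
  collar : PartialEquiv (Y × ℝ) W
  source_eq : collar.source = Set.univ ×ˢ Set.Ico c (c + ε)
  isOpen_target : IsOpen collar.target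
  smooth : ContMDiffOn ((𝓡 (2 * m + 1)).prod 𝓘(ℝ, ℝ)) (𝓡∂ (2 * m + 2)) ∞ collar collar.source
  smooth_symm :
    ContMDiffOn (𝓡∂ (2 * m + 2)) ((𝓡 (2 * m + 1)).prod 𝓘(ℝ, ℝ)) ∞ collar.symm collar.target
  boundary_eq : collar '' (Set.univ ×ˢ {c}) = (𝓡∂ (2 * m + 2)).boundary W
  symplectic : ∀ p ∈ collar.source,
    pullbackOn ((𝓡 (2 * m + 1)).prod 𝓘(ℝ, ℝ)) (𝓡∂ (2 * m + 2)) collar.source collar Ω p =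
      extD ((𝓡 (2 * m + 1)).prod 𝓘(ℝ, ℝ)) (liouvilleForm θ) p

namespace ConcaveBoundary

variable {Ω : DForm (𝓡∂ (2 * m + 2)) W 2} {θ : DForm (𝓡 (2 * m + 1)) Y 1} {c : ℝ}
  (B : ConcaveBoundary Ω θ c)

/-- The Liouville coordinate, meaningful on the collar. -/
def rho (w : W) : ℝ := (B.collar.symm w).2

/-- The projection to `Y`, meaningful on the collar; on `∂W` it is the identification
`∂W = Y`. -/
def proj (w : W) : Y := (B.collar.symm w).1

/-- `J` is of contact type along `∂W`: `dρ ∘ J = -ρ θ` at the points of `∂W`. -/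
def IsContactType
    (J : ∀ w : W, TangentSpace (𝓡∂ (2 * m + 2)) w →L[ℝ] TangentSpace (𝓡∂ (2 * m + 2)) w) :
    Prop :=
  ∀ w ∈ (𝓡∂ (2 * m + 2)).boundary W, ∀ v : TangentSpace (𝓡∂ (2 * m + 2)) w,
    (mfderiv (𝓡∂ (2 * m + 2)) 𝓘(ℝ, ℝ) B.rho w (J w v) : ℝ) =
      -(B.rho w * pullback (𝓡∂ (2 * m + 2)) (𝓡 (2 * m + 1)) B.proj θ w ![v])

variable {S : Type*} [TopologicalSpace S] [ChartedSpace (EuclideanHalfSpace 2) S]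
  [IsManifold (𝓡∂ 2) ∞ S] [T2Space S] [CompactSpace S]

/-- The pairing `[Ω; cθ](u) = ∫_Σ u^*Ω - ∫_{∂Σ} u^*(cθ)` of the relative de Rham class of
`(Ω, cθ)` with a map `u : (Σ, ∂Σ) → (W, ∂W)`, where `∂W` is identified with `Y`. -/
def relClass (j : ∀ z : S, TangentSpace (𝓡∂ 2) z →L[ℝ] TangentSpace (𝓡∂ 2) z) (u : S → W) : ℝ :=
  surfaceIntegral j (pullback (𝓡∂ 2) (𝓡∂ (2 * m + 2)) u Ω) -
    boundaryIntegral j (pullback (𝓡∂ 2) (𝓡 (2 * m + 1)) (B.proj ∘ u) (fun y => c • θ y))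

end ConcaveBoundary

end Concave

end FloerPositivity

end

noncomputable section

namespace FloerPositivity

section FormCalculus

variable {E : Type*} [NormedAddCommGroup E] [NormedSpace ℝ E]
  {H : Type*} [TopologicalSpace H] {I : ModelWithCorners ℝ E H}
  {M : Type*} [TopologicalSpace M] [ChartedSpace H M]
  {E' : Type*} [NormedAddCommGroup E'] [NormedSpace ℝ E']
  {H' : Type*} [TopologicalSpace H'] {I' : ModelWithCorners ℝ E' H'}
  {M' : Type*} [TopologicalSpace M'] [ChartedSpace H' M']

theorem extDerivWithin_congr_set {k : ℕ} {ζ : E → E [⋀^Fin k]→L[ℝ] ℝ} {s t : Set E} {x : E}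
    (h : s =ᶠ[𝓝 x] t) : extDerivWithin ζ s x = extDerivWithin ζ t x := by
  rw [extDerivWithin, extDerivWithin, fderivWithin_congr_set h]

theorem extDerivWithin_oneForm_apply {ζ : E → E [⋀^Fin 1]→L[ℝ] ℝ} {s : Set E} {x : E} (v w : E) :
    extDerivWithin ζ s x ![v, w] =
      fderivWithin ℝ ζ s x v ![w] - fderivWithin ℝ ζ s x w ![v] := by
  rw [extDerivWithin, ContinuousAlternatingMap.alternatizeUncurryFin_apply, Fin.sum_univ_two]
  have h0 : Fin.removeNth 0 ![v, w] = ![w] := by ext i; fin_cases i; rfl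
  have h1 : Fin.removeNth 1 ![v, w] = ![v] := by ext i; fin_cases i; rfl
  rw [h0, h1]
  simp [sub_eq_add_neg]

section TwoForms

variable {V : Type*} [AddCommGroup V] [Module ℝ V] [TopologicalSpace V] (φ : V [⋀^Fin 2]→L[ℝ] ℝ)

theorem twoForm_swap (v w : V) : φ ![v, w] = -φ ![w, v] := by
  refine Eq.trans ?_ (φ.map_swap ![w, v] (i := 0) (j := 1) (by simp))
  change φ _ = φ _
  congr 1
  ext i
  fin_cases i <;> rfl

theorem twoForm_self (v : V) : φ ![v, v] = 0 := by
  linarith [twoForm_swap φ v v]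

theorem twoForm_add_left (v v' w : V) : φ ![v + v', w] = φ ![v, w] + φ ![v', w] :=
  φ.map_vecCons_add ![w] v v'

theorem twoForm_smul_left (r : ℝ) (v w : V) : φ ![r • v, w] = r * φ ![v, w] :=
  φ.map_vecCons_smul ![w] r v

theorem twoForm_add_right (v w w' : V) : φ ![v, w + w'] = φ ![v, w] + φ ![v, w'] := by
  rw [twoForm_swap, twoForm_add_left, twoForm_swap φ w, twoForm_swap φ w']
  ring

theorem twoForm_smul_right (r : ℝ) (v w : V) : φ ![v, r • w] = r * φ ![v, w] := by
  rw [twoForm_swap, twoForm_smul_left, twoForm_swap φ w]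
  ring

theorem twoForm_sub_left (v v' w : V) : φ ![v - v', w] = φ ![v, w] - φ ![v', w] := by
  rw [sub_eq_add_neg, ← neg_one_smul ℝ v', twoForm_add_left, twoForm_smul_left]
  ring

theorem twoForm_sub_right (v w w' : V) : φ ![v, w - w'] = φ ![v, w] - φ ![v, w'] := by
  rw [sub_eq_add_neg, ← neg_one_smul ℝ w', twoForm_add_right, twoForm_smul_right]
  ring

end TwoForms

theorem chartDeriv_self [IsManifold I ∞ M] (x : M) :
    chartDeriv I x x = ContinuousLinearMap.id ℝ E :=
  have : IsManifold I 1 M := .of_le (n := ∞) (by simp)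
  mfderiv_extChartAt_self

theorem chartDeriv_chartSymmDeriv [IsManifold I ∞ M] {x₀ : M} {y : E}
    (hy : y ∈ (extChartAt I x₀).target) (v : E) :
    chartDeriv I x₀ ((extChartAt I x₀).symm y) (chartSymmDeriv I x₀ y v) = v :=
  have : IsManifold I 1 M := .of_le (n := ∞) (by simp)
  DFunLike.congr_fun (mfderiv_extChartAt_comp_mfderivWithin_extChartAt_symm hy) v

theorem chartSymmDeriv_chartDeriv [IsManifold I ∞ M] {x₀ : M} {y : E}
    (hy : y ∈ (extChartAt I x₀).target) (v : TangentSpace I ((extChartAt I x₀).symm y)) :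
    chartSymmDeriv I x₀ y (chartDeriv I x₀ ((extChartAt I x₀).symm y) v) = v :=
  have : IsManifold I 1 M := .of_le (n := ∞) (by simp)
  DFunLike.congr_fun (mfderivWithin_extChartAt_symm_comp_mfderiv_extChartAt hy) v

theorem formInChart_comp_chartDeriv [IsManifold I ∞ M] {k : ℕ} (η : DForm I M k) {x₀ x : M}
    (hx : x ∈ (extChartAt I x₀).source) :
    (formInChart I η x₀ (extChartAt I x₀ x)).compContinuousLinearMap (chartDeriv I x₀ x) = η x := by
  obtain ⟨y, hy, rfl⟩ : ∃ y ∈ (extChartAt I x₀).target, (extChartAt I x₀).symm y = x :=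
    ⟨_, (extChartAt I x₀).map_source hx, (extChartAt I x₀).left_inv hx⟩
  rw [(extChartAt I x₀).right_inv hy]
  ext v
  simp only [formInChart, ContinuousAlternatingMap.compContinuousLinearMap_apply]
  congr 1
  ext i
  exact chartSymmDeriv_chartDeriv hy (v i)

theorem formInChart_chartDeriv_apply_two [IsManifold I ∞ M] (η : DForm I M 2) {x₀ x : M}
    (hx : x ∈ (extChartAt I x₀).source) (v w : TangentSpace I x) :
    formInChart I η x₀ (extChartAt I x₀ x) ![chartDeriv I x₀ x v, chartDeriv I x₀ x w] =
      η x ![v, w] := by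
  conv_rhs => rw [← formInChart_comp_chartDeriv η hx]
  rw [ContinuousAlternatingMap.compContinuousLinearMap_apply]
  congr 1
  ext i
  fin_cases i <;> rfl

theorem formInChart_apply_one {η : DForm I M 1} {x₀ : M} {y : E} (v : E) :
    formInChart I η x₀ y ![v] = η ((extChartAt I x₀).symm y) ![chartSymmDeriv I x₀ y v] := by
  rw [formInChart, ContinuousAlternatingMap.compContinuousLinearMap_apply]
  congr 1
  ext i
  fin_cases i
  rfl

theorem formInChart_apply_two {η : DForm I M 2} {x₀ : M} {y : E} (v w : E) :
    formInChart I η x₀ y ![v, w] =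
      η ((extChartAt I x₀).symm y) ![chartSymmDeriv I x₀ y v, chartSymmDeriv I x₀ y w] := by
  rw [formInChart, ContinuousAlternatingMap.compContinuousLinearMap_apply]
  congr 1
  ext i
  fin_cases i <;> rfl

theorem pullback_apply_one {η : DForm I' M' 1} {f : M → M'} {x : M} (v : TangentSpace I x) :
    pullback I I' f η x ![v] = η (f x) ![mfderiv I I' f x v] := by
  rw [pullback, ContinuousAlternatingMap.compContinuousLinearMap_apply]
  congr 1
  ext i
  fin_cases i
  rfl

theorem pullback_apply_two {η : DForm I' M' 2} {f : M → M'} {x : M} (v w : TangentSpace I x) :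
    pullback I I' f η x ![v, w] = η (f x) ![mfderiv I I' f x v, mfderiv I I' f x w] := by
  rw [pullback, ContinuousAlternatingMap.compContinuousLinearMap_apply]
  congr 1
  ext i
  fin_cases i <;> rfl

theorem pullback_id {k : ℕ} (η : DForm I M k) : pullback I I id η = η := by
  funext x
  ext v
  simp [pullback, mfderiv_id]

theorem hasFDerivWithinAt_inCharts [IsManifold I ∞ M] [IsManifold I' ∞ M'] {f : M → M'}
    {z₀ : M} {w₀ : M'} {y : E} (hy : y ∈ (extChartAt I z₀).target)
    (hf : MDifferentiableAt I I' f ((extChartAt I z₀).symm y))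
    (hw : f ((extChartAt I z₀).symm y) ∈ (extChartAt I' w₀).source) :
    HasFDerivWithinAt (extChartAt I' w₀ ∘ f ∘ (extChartAt I z₀).symm)
      (chartDeriv I' w₀ (f ((extChartAt I z₀).symm y)) ∘L
        mfderiv I I' f ((extChartAt I z₀).symm y) ∘L chartSymmDeriv I z₀ y) (Set.range I) y := by
  have : IsManifold I 1 M := .of_le (n := ∞) (by simp)
  have : IsManifold I' 1 M' := .of_le (n := ∞) (by simp)
  have h1 : HasMFDerivWithinAt 𝓘(ℝ, E) I (extChartAt I z₀).symm (Set.range I) y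
      (chartSymmDeriv I z₀ y) :=
    (mdifferentiableWithinAt_extChartAt_symm hy).hasMFDerivWithinAt
  have h2 := hf.hasMFDerivAt.comp_hasMFDerivWithinAt y h1
  have h3 : HasMFDerivAt I' 𝓘(ℝ, E') (extChartAt I' w₀) (f ((extChartAt I z₀).symm y))
      (chartDeriv I' w₀ (f ((extChartAt I z₀).symm y))) :=
    (mdifferentiableAt_extChartAt (by simpa using hw)).hasMFDerivAt
  exact (h3.comp_hasMFDerivWithinAt y h2).hasFDerivWithinAt

theorem uniqueDiffWithinAt_range {y : E} {x₀ : M} (hy : y ∈ (extChartAt I x₀).target) :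
    UniqueDiffWithinAt ℝ (Set.range I) y :=
  I.uniqueDiffOn y (extChartAt_target_subset_range x₀ hy)

theorem formInChart_pullback [IsManifold I ∞ M] [IsManifold I' ∞ M'] {k : ℕ} (η : DForm I' M' k)
    {f : M → M'} {z₀ : M} {w₀ : M'} {y : E} (hy : y ∈ (extChartAt I z₀).target)
    (hf : MDifferentiableAt I I' f ((extChartAt I z₀).symm y))
    (hw : f ((extChartAt I z₀).symm y) ∈ (extChartAt I' w₀).source) :
    formInChart I (pullback I I' f η) z₀ y =
      (formInChart I' η w₀ ((extChartAt I' w₀ ∘ f ∘ (extChartAt I z₀).symm) y)).compContinuousLinearMap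
        (fderivWithin ℝ (extChartAt I' w₀ ∘ f ∘ (extChartAt I z₀).symm) (Set.range I) y) := by
  rw [(hasFDerivWithinAt_inCharts hy hf hw).fderivWithin (uniqueDiffWithinAt_range hy)]
  ext v
  simp only [formInChart, pullback, ContinuousAlternatingMap.compContinuousLinearMap_apply]
  rw [← formInChart_comp_chartDeriv η hw]
  rfl

theorem contDiffWithinAt_inCharts [IsManifold I ∞ M] [IsManifold I' ∞ M'] {f : M → M'}
    {z₀ : M} {w₀ : M'} {y : E} (hy : y ∈ (extChartAt I z₀).target)
    (hf : ContMDiffAt I I' ∞ f ((extChartAt I z₀).symm y))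
    (hw : f ((extChartAt I z₀).symm y) ∈ (extChartAt I' w₀).source) :
    ContDiffWithinAt ℝ ∞ (extChartAt I' w₀ ∘ f ∘ (extChartAt I z₀).symm) (Set.range I) y := by
  have h1 := contMDiffWithinAt_extChartAt_symm_range (I := I) (n := ∞) z₀ hy
  have h2 := hf.comp_contMDiffWithinAt y h1
  have h3 : ContMDiffAt I' 𝓘(ℝ, E') ∞ (extChartAt I' w₀) (f ((extChartAt I z₀).symm y)) :=
    contMDiffAt_extChartAt' (by simpa using hw)
  exact (h3.comp_contMDiffWithinAt y h2).contDiffWithinAt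

theorem chart_preimage_mem_nhdsWithin {f : M → M'} {z₀ : M} {y : E}
    (hy : y ∈ (extChartAt I z₀).target) {V : Set M'}
    (hf : ContinuousAt f ((extChartAt I z₀).symm y)) (hV : V ∈ 𝓝 (f ((extChartAt I z₀).symm y))) :
    (extChartAt I z₀).target ∩ (f ∘ (extChartAt I z₀).symm) ⁻¹' V ∈ 𝓝[Set.range I] y := by
  refine Filter.inter_mem (extChartAt_target_mem_nhdsWithin_of_mem hy) ?_
  have h1 : ContinuousWithinAt (extChartAt I z₀).symm (Set.range I) y :=
    (continuousAt_extChartAt_symm'' hy).continuousWithinAt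
  exact hf.comp_continuousWithinAt h1 hV

/-- Alternatization of continuous multilinear maps, as a continuous linear map. -/
def alternatizationCLM (E : Type*) [NormedAddCommGroup E] [NormedSpace ℝ E] (k : ℕ) :
    ContinuousMultilinearMap ℝ (fun _ : Fin k => E) ℝ →L[ℝ] E [⋀^Fin k]→L[ℝ] ℝ :=
  LinearMap.mkContinuous
    { toFun := fun f => ContinuousMultilinearMap.alternatization f
      map_add' := fun f g => map_add _ f g
      map_smul' := fun r f => by
        ext v
        simp [ContinuousMultilinearMap.alternatization_apply_apply, Finset.mul_sum,
          mul_smul_comm] }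
    (Fintype.card (Equiv.Perm (Fin k))) fun f => by
      refine ContinuousAlternatingMap.opNorm_le_bound _ (by positivity) fun v => ?_
      simp only [LinearMap.coe_mk, AddHom.coe_mk,
        ContinuousMultilinearMap.alternatization_apply_apply]
      refine (norm_sum_le _ _).trans ?_
      rw [mul_assoc, ← nsmul_eq_mul, ← Finset.card_univ]
      refine Finset.sum_le_card_nsmul _ _ _ fun σ _ => ?_
      have h1 : ‖Equiv.Perm.sign σ • f (v ∘ σ)‖ = ‖f (v ∘ σ)‖ := by
        rcases Int.units_eq_one_or (Equiv.Perm.sign σ) with h | h <;> simp [h]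
      rw [h1]
      refine (f.le_opNorm _).trans (le_of_eq ?_)
      rw [← Equiv.prod_comp σ (fun i => ‖v i‖)]
      rfl

theorem alternatizationCLM_toContinuousMultilinearMap {k : ℕ} (f : E [⋀^Fin k]→L[ℝ] ℝ) :
    alternatizationCLM E k f.toContinuousMultilinearMap = (k.factorial : ℝ) • f := by
  apply ContinuousAlternatingMap.toAlternatingMap_injective
  change (ContinuousMultilinearMap.alternatization f.toContinuousMultilinearMap).toAlternatingMap = _
  rw [ContinuousMultilinearMap.alternatization_apply_toAlternatingMap]
  refine (AlternatingMap.coe_alternatization f.toAlternatingMap).trans ?_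
  ext v
  simp

theorem contDiff_compContinuousLinearMap {k : ℕ} {n : WithTop ℕ∞} :
    ContDiff ℝ n (fun p : (E' [⋀^Fin k]→L[ℝ] ℝ) × (E →L[ℝ] E') =>
      p.1.compContinuousLinearMap p.2) := by
  have h1 : ContDiff ℝ n (fun p : (E' [⋀^Fin k]→L[ℝ] ℝ) × (E →L[ℝ] E') =>
      ContinuousMultilinearMap.compContinuousLinearMapContinuousMultilinear ℝ
        (fun _ : Fin k => E) (fun _ => E') ℝ (fun _ => p.2)
        (ContinuousAlternatingMap.toContinuousMultilinearMapCLM ℝ p.1)) := by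
    refine ContDiff.clm_apply ?_ ?_
    · exact (ContinuousMultilinearMap.contDiff _).comp (contDiff_pi.2 fun _ => contDiff_snd)
    · exact (ContinuousLinearMap.contDiff _).comp contDiff_fst
  have h2 := (((k.factorial : ℝ)⁻¹ • alternatizationCLM E k).contDiff (n := n)).comp h1
  convert! h2 using 1
  funext p
  have h3 := alternatizationCLM_toContinuousMultilinearMap (p.1.compContinuousLinearMap p.2)
  have h4 : (k.factorial : ℝ) ≠ 0 := by positivity
  rw [← inv_smul_eq_iff₀ h4] at h3
  exact h3.symm

end FormCalculus

section FormCalculus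

variable {E : Type*} [NormedAddCommGroup E] [NormedSpace ℝ E]
  {H : Type*} [TopologicalSpace H] {I : ModelWithCorners ℝ E H}
  {M : Type*} [TopologicalSpace M] [ChartedSpace H M]
  {E' : Type*} [NormedAddCommGroup E'] [NormedSpace ℝ E']
  {H' : Type*} [TopologicalSpace H'] {I' : ModelWithCorners ℝ E' H'}
  {M' : Type*} [TopologicalSpace M'] [ChartedSpace H' M']

theorem SmoothForm.contDiffWithinAt {k : ℕ} {η : DForm I M k} (hη : SmoothForm I η) {x₀ : M}
    {y : E} (hy : y ∈ (extChartAt I x₀).target) :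
    ContDiffWithinAt ℝ ∞ (formInChart I η x₀) (Set.range I) y :=
  (hη x₀ y hy).mono_of_mem_nhdsWithin (extChartAt_target_mem_nhdsWithin_of_mem hy)

theorem SmoothForm.differentiableWithinAt {k : ℕ} {η : DForm I M k} (hη : SmoothForm I η) {x₀ : M}
    {y : E} (hy : y ∈ (extChartAt I x₀).target) :
    DifferentiableWithinAt ℝ (formInChart I η x₀) (Set.range I) y :=
  (hη.contDiffWithinAt hy).differentiableWithinAt (by simp)

/-- Near a point, the range of the model with corners can be cut down by an open set. -/
theorem exists_isOpen_inter_range_subset {s : Set E} {y : E} (hs : s ∈ 𝓝[Set.range I] y)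
    (hy : y ∈ Set.range I) :
    ∃ O : Set E, IsOpen O ∧ y ∈ O ∧ Set.range I ∩ O ⊆ s ∧ UniqueDiffOn ℝ (Set.range I ∩ O) ∧
      y ∈ closure (interior (Set.range I ∩ O)) := by
  obtain ⟨O, hO, hyO, hOs⟩ := mem_nhdsWithin.1 hs
  refine ⟨O, hO, hyO, by rwa [Set.inter_comm], I.uniqueDiffOn.inter hO, ?_⟩
  rw [interior_inter, hO.interior_eq]
  exact hO.closure_inter ⟨I.range_subset_closure_interior hy, hyO⟩

theorem formInChart_extD_self [IsManifold I ∞ M] {k : ℕ} (η : DForm I M k) (x : M) :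
    formInChart I (extD I η) x (extChartAt I x x) =
      extDerivWithin (formInChart I η x) (Set.range I) (extChartAt I x x) := by
  have h := formInChart_comp_chartDeriv (extD I η) (mem_extChartAt_source (I := I) x)
  rw [extD, chartDeriv_self] at h
  ext v
  exact DFunLike.congr_fun h v

theorem formInChart_pullback_eventuallyEq [IsManifold I ∞ M] [IsManifold I' ∞ M'] {k : ℕ}
    (η : DForm I' M' k) {f : M → M'} {U : Set M} (hU : IsOpen U) (hf : ContMDiffOn I I' ∞ f U)
    {z₀ : M} {w₀ : M'} {y : E} (hy : y ∈ (extChartAt I z₀).target)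
    (hyU : (extChartAt I z₀).symm y ∈ U)
    (hw : f ((extChartAt I z₀).symm y) ∈ (extChartAt I' w₀).source) :
    ∀ᶠ y' in 𝓝[Set.range I] y, (extChartAt I' w₀ ∘ f ∘ (extChartAt I z₀).symm) y' ∈
        (extChartAt I' w₀).target ∧ formInChart I (pullback I I' f η) z₀ y' =
      (formInChart I' η w₀ ((extChartAt I' w₀ ∘ f ∘ (extChartAt I z₀).symm) y')).compContinuousLinearMap
        (fderivWithin ℝ (extChartAt I' w₀ ∘ f ∘ (extChartAt I z₀).symm) (Set.range I) y') := by
  have hfy : ContinuousAt f ((extChartAt I z₀).symm y) :=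
    (hf.contMDiffAt (hU.mem_nhds hyU)).continuousAt
  filter_upwards [chart_preimage_mem_nhdsWithin hy hfy (extChartAt_source_mem_nhds' hw),
    chart_preimage_mem_nhdsWithin (f := id) hy continuousAt_id (hU.mem_nhds hyU)] with y' h1 h2
  exact ⟨(extChartAt I' w₀).map_source h1.2, formInChart_pullback η h1.1
    ((hf.contMDiffAt (hU.mem_nhds h2.2)).mdifferentiableAt (by simp)) h1.2⟩

theorem contDiffWithinAt_formInChart_pullback [IsManifold I ∞ M] [IsManifold I' ∞ M'] {k : ℕ}
    {η : DForm I' M' k} (hη : SmoothForm I' η) {f : M → M'} {U : Set M} (hU : IsOpen U)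
    (hf : ContMDiffOn I I' ∞ f U) {z₀ : M} {y : E} (hy : y ∈ (extChartAt I z₀).target)
    (hyU : (extChartAt I z₀).symm y ∈ U) :
    ContDiffWithinAt ℝ ∞ (formInChart I (pullback I I' f η) z₀) (Set.range I) y := by
  set w₀ := f ((extChartAt I z₀).symm y) with hw₀
  have hw : f ((extChartAt I z₀).symm y) ∈ (extChartAt I' w₀).source := mem_extChartAt_source _
  have hyr : y ∈ Set.range I := extChartAt_target_subset_range z₀ hy
  have hev := formInChart_pullback_eventuallyEq η hU hf hy hyU hw
  have hF : ContDiffWithinAt ℝ ∞ (extChartAt I' w₀ ∘ f ∘ (extChartAt I z₀).symm) (Set.range I) y :=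
    contDiffWithinAt_inCharts hy (hf.contMDiffAt (hU.mem_nhds hyU)) hw
  have hDF : ContDiffWithinAt ℝ ∞
      (fderivWithin ℝ (extChartAt I' w₀ ∘ f ∘ (extChartAt I z₀).symm) (Set.range I))
      (Set.range I) y := hF.fderivWithin_right I.uniqueDiffOn (by simp) hyr
  have h1 : ContDiffWithinAt ℝ ∞
      (formInChart I' η w₀ ∘ (extChartAt I' w₀ ∘ f ∘ (extChartAt I z₀).symm)) (Set.range I) y := by
    have := (hη w₀ _ ((extChartAt I' w₀).map_source hw)).comp_of_preimage_mem_nhdsWithin y hF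
      (hev.mono fun _ h => h.1)
    exact this
  have h2 := (contDiff_compContinuousLinearMap (E := E) (E' := E') (k := k)
    (n := ∞)).contDiffAt.comp_contDiffWithinAt y (h1.prodMk hDF)
  exact h2.congr_of_eventuallyEq (hev.mono fun _ h => h.2) (hev.self_of_nhdsWithin hyr).2

theorem SmoothForm.pullback [IsManifold I ∞ M] [IsManifold I' ∞ M'] {k : ℕ}
    {η : DForm I' M' k} (hη : SmoothForm I' η) {f : M → M'} (hf : ContMDiff I I' ∞ f) :
    SmoothForm I (FloerPositivity.pullback I I' f η) := fun z₀ _ hy =>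
  (contDiffWithinAt_formInChart_pullback hη isOpen_univ hf.contMDiffOn hy
    (Set.mem_univ _)).mono (extChartAt_target_subset_range z₀)

/-- The exterior derivative is natural; expressed in a chart of the source. -/
theorem formInChart_pullback_extD [IsManifold I ∞ M] [IsManifold I' ∞ M'] {k : ℕ}
    {η : DForm I' M' k} (hη : SmoothForm I' η) {f : M → M'} {U : Set M} (hU : IsOpen U)
    (hf : ContMDiffOn I I' ∞ f U) {z₀ : M} {y : E} (hy : y ∈ (extChartAt I z₀).target)
    (hyU : (extChartAt I z₀).symm y ∈ U) :
    formInChart I (FloerPositivity.pullback I I' f (extD I' η)) z₀ y =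
      extDerivWithin (formInChart I (FloerPositivity.pullback I I' f η) z₀) (Set.range I) y := by
  set w₀ := f ((extChartAt I z₀).symm y) with hw₀
  have hw : f ((extChartAt I z₀).symm y) ∈ (extChartAt I' w₀).source := mem_extChartAt_source _
  have hyr : y ∈ Set.range I := extChartAt_target_subset_range z₀ hy
  have hfy := hf.contMDiffAt (hU.mem_nhds hyU)
  have hev := formInChart_pullback_eventuallyEq η hU hf hy hyU hw
  have hF : ContDiffWithinAt ℝ ∞ (extChartAt I' w₀ ∘ f ∘ (extChartAt I z₀).symm) (Set.range I) y :=
    contDiffWithinAt_inCharts hy hfy hw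
  rw [formInChart_pullback _ hy (hfy.mdifferentiableAt (by simp)) hw]
  set F := extChartAt I' w₀ ∘ f ∘ (extChartAt I z₀).symm with hFdef
  have hFy : F y = extChartAt I' w₀ w₀ := rfl
  rw [hFy, formInChart_extD_self, ← hFy]
  obtain ⟨O, hO, hyO, hOs, hOu, hOc⟩ := exists_isOpen_inter_range_subset hev hyr
  have hset : (Set.range I ∩ O : Set E) =ᶠ[𝓝 y] (Set.range I : Set E) := by
    filter_upwards [hO.mem_nhds hyO] with y' hy'
    exact propext ⟨fun h => h.1, fun h => ⟨h, hy'⟩⟩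
  have hfd : ∀ y' ∈ O, fderivWithin ℝ F (Set.range I ∩ O) y' = fderivWithin ℝ F (Set.range I) y' :=
    fun y' hy' => fderivWithin_inter (hO.mem_nhds hy')
  have key := extDerivWithin_pullback (f := F) (s := Set.range I ∩ O)
    (t := Set.range I') (x := y) (r := ∞)
    (hη.differentiableWithinAt ((extChartAt I' w₀).map_source hw))
    (hF.mono Set.inter_subset_left)
    (by rw [minSmoothness_of_isRCLikeNormedField]; exact WithTop.coe_le_coe.2 le_top) hOu hOc ⟨hyr, hyO⟩
    (fun y' hy' => extChartAt_target_subset_range w₀ (hOs hy').1)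
  rw [← extDerivWithin_congr_set hset, ← hfd y hyO, ← key]
  exact extDerivWithin_congr' (fun y' hy' => by rw [hfd y' hy'.2]; exact (hOs hy').2.symm)
    ⟨hyr, hyO⟩

theorem formInChart_extD [IsManifold I ∞ M] {k : ℕ} {η : DForm I M k} (hη : SmoothForm I η)
    {z₀ : M} {y : E} (hy : y ∈ (extChartAt I z₀).target) :
    formInChart I (extD I η) z₀ y = extDerivWithin (formInChart I η z₀) (Set.range I) y := by
  have h := formInChart_pullback_extD hη isOpen_univ contMDiff_id.contMDiffOn hy (Set.mem_univ _)
  rwa [pullback_id, pullback_id] at h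

theorem extD_pullback [IsManifold I ∞ M] [IsManifold I' ∞ M'] {k : ℕ}
    {η : DForm I' M' k} (hη : SmoothForm I' η) {f : M → M'} (hf : ContMDiff I I' ∞ f) :
    extD I (FloerPositivity.pullback I I' f η) =
      FloerPositivity.pullback I I' f (extD I' η) := by
  funext z
  rw [← formInChart_comp_chartDeriv (FloerPositivity.pullback I I' f (extD I' η))
    (mem_extChartAt_source (I := I) z), formInChart_pullback_extD hη isOpen_univ hf.contMDiffOn
    (mem_extChartAt_target z) (Set.mem_univ _)]
  rfl

theorem SmoothForm.extD [IsManifold I ∞ M] {k : ℕ} {η : DForm I M k} (hη : SmoothForm I η) :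
    SmoothForm I (extD I η) := by
  intro z₀ y hy
  have h1 : ContDiffWithinAt ℝ ∞ (extDerivWithin (formInChart I η z₀) (Set.range I))
      (Set.range I) y :=
    (ContinuousAlternatingMap.alternatizeUncurryFinCLM ℝ E ℝ).contDiff.contDiffAt.comp_contDiffWithinAt y
      ((hη.contDiffWithinAt hy).fderivWithin_right I.uniqueDiffOn (by simp)
        (extChartAt_target_subset_range z₀ hy))
  exact (h1.mono (extChartAt_target_subset_range z₀)).congr
    (fun y' hy' => formInChart_extD hη hy') (formInChart_extD hη hy)

theorem SmoothForm.add {k : ℕ} {η η' : DForm I M k} (hη : SmoothForm I η)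
    (hη' : SmoothForm I η') : SmoothForm I (fun x => η x + η' x) := fun x₀ =>
  (hη x₀).add (hη' x₀)

theorem SmoothForm.sub {k : ℕ} {η η' : DForm I M k} (hη : SmoothForm I η)
    (hη' : SmoothForm I η') : SmoothForm I (fun x => η x - η' x) := fun x₀ => by
  refine ((hη x₀).sub (hη' x₀)).congr fun y _ => ?_
  rfl

theorem contDiffOn_comp_extChartAt_symm [IsManifold I ∞ M] {f : M → ℝ}
    (hf : ContMDiff I 𝓘(ℝ, ℝ) ∞ f) (x₀ : M) :
    ContDiffOn ℝ ∞ (f ∘ (extChartAt I x₀).symm) (extChartAt I x₀).target :=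
  (hf.comp_contMDiffOn (contMDiffOn_extChartAt_symm x₀)).contDiffOn

theorem SmoothForm.smul [IsManifold I ∞ M] {k : ℕ} {f : M → ℝ} (hf : ContMDiff I 𝓘(ℝ, ℝ) ∞ f)
    {η : DForm I M k} (hη : SmoothForm I η) : SmoothForm I (fun x => f x • η x) := fun x₀ =>
  (contDiffOn_comp_extChartAt_symm hf x₀).smul (hη x₀)

theorem SmoothForm.const_smul [IsManifold I ∞ M] {k : ℕ} (r : ℝ)
    {η : DForm I M k} (hη : SmoothForm I η) : SmoothForm I (fun x => r • η x) :=
  SmoothForm.smul (f := fun _ => r) contMDiff_const hη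

theorem smoothForm_zero {k : ℕ} : SmoothForm I (0 : DForm I M k) := fun x₀ => by
  refine (contDiffOn_const (c := (0 : E [⋀^Fin k]→L[ℝ] ℝ))).congr fun y _ => ?_
  ext v
  rfl

theorem SmoothForm.sum {k : ℕ} {ι : Type*} (s : Finset ι) {η : ι → DForm I M k}
    (hη : ∀ i ∈ s, SmoothForm I (η i)) : SmoothForm I (∑ i ∈ s, η i) := by
  classical
  induction s using Finset.induction_on with
  | empty => exact smoothForm_zero
  | insert a s ha ih =>
    rw [Finset.sum_insert ha]
    exact (hη a (by simp)).add (ih fun i hi => hη i (Finset.mem_insert_of_mem hi))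

theorem extD_add [IsManifold I ∞ M] {k : ℕ} {η η' : DForm I M k} (hη : SmoothForm I η)
    (hη' : SmoothForm I η') :
    extD I (fun x => η x + η' x) = fun x => extD I η x + extD I η' x := by
  funext x
  have hx := mem_extChartAt_target (I := I) x
  have h := extDerivWithin_add (uniqueDiffWithinAt_range hx) (hη.differentiableWithinAt hx)
    (hη'.differentiableWithinAt hx)
  ext v
  exact DFunLike.congr_fun h _

theorem extD_zero {k : ℕ} : extD I (0 : DForm I M k) = 0 := by
  funext x
  have h : formInChart I (0 : DForm I M k) x = fun _ => 0 := by
    funext y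
    ext v
    rfl
  ext v
  rw [extD, h, extDerivWithin, fderivWithin_fun_const]
  exact DFunLike.congr_fun (map_zero (ContinuousAlternatingMap.alternatizeUncurryFinCLM ℝ E ℝ)) _

theorem extD_sum [IsManifold I ∞ M] {k : ℕ} {ι : Type*} (s : Finset ι) {η : ι → DForm I M k}
    (hη : ∀ i ∈ s, SmoothForm I (η i)) : extD I (∑ i ∈ s, η i) = ∑ i ∈ s, extD I (η i) := by
  classical
  induction s using Finset.induction_on with
  | empty => exact extD_zero
  | insert a s ha ih =>
    rw [Finset.sum_insert ha, Finset.sum_insert ha,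
      ← ih fun i hi => hη i (Finset.mem_insert_of_mem hi)]
    exact extD_add (hη a (by simp)) (SmoothForm.sum s fun i hi => hη i (Finset.mem_insert_of_mem hi))

theorem extD_const_smul [IsManifold I ∞ M] {k : ℕ} (r : ℝ) (η : DForm I M k) :
    extD I (fun x => r • η x) = fun x => r • extD I η x := by
  funext x
  have hx := mem_extChartAt_target (I := I) x
  have h := extDerivWithin_smul r (formInChart I η x) (uniqueDiffWithinAt_range hx)
  ext v
  exact DFunLike.congr_fun h _

theorem extD_sub [IsManifold I ∞ M] {k : ℕ} {η η' : DForm I M k} (hη : SmoothForm I η)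
    (hη' : SmoothForm I η') :
    extD I (fun x => η x - η' x) = fun x => extD I η x - extD I η' x := by
  have h1 : (fun x => η x - η' x) = fun x => η x + (-1 : ℝ) • η' x := by
    funext x
    ext v
    simp [sub_eq_add_neg]
  rw [h1, extD_add hη (hη'.const_smul _), extD_const_smul]
  funext x
  ext v
  simp [sub_eq_add_neg]

theorem extDerivWithin_smul_oneForm_apply {g : E → ℝ} {ζ : E → E [⋀^Fin 1]→L[ℝ] ℝ} {s : Set E}
    {y : E} (hs : UniqueDiffWithinAt ℝ s y) (hg : DifferentiableWithinAt ℝ g s y)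
    (hζ : DifferentiableWithinAt ℝ ζ s y) (v w : E) :
    extDerivWithin (fun y => g y • ζ y) s y ![v, w] =
      fderivWithin ℝ g s y v * ζ y ![w] - fderivWithin ℝ g s y w * ζ y ![v] +
        g y * extDerivWithin ζ s y ![v, w] := by
  rw [extDerivWithin_oneForm_apply, extDerivWithin_oneForm_apply, fderivWithin_fun_smul hs hg hζ]
  simp only [add_apply, smul_apply,
    ContinuousLinearMap.smulRight_apply, ContinuousAlternatingMap.add_apply,
    ContinuousAlternatingMap.smul_apply, smul_eq_mul]
  ring

variable (I) in
/-- The differential of a real function, with values in `ℝ`. -/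
def differential (f : M → ℝ) (x : M) : TangentSpace I x →L[ℝ] ℝ := mfderiv I 𝓘(ℝ, ℝ) f x

theorem differential_eq_fderivWithin {f : M → ℝ} {x : M}
    (hf : MDifferentiableAt I 𝓘(ℝ, ℝ) f x) :
    differential I f x =
      fderivWithin ℝ (f ∘ (extChartAt I x).symm) (Set.range I) (extChartAt I x x) :=
  hf.mfderiv

theorem formInChart_self_apply_one [IsManifold I ∞ M] (η : DForm I M 1) (x : M)
    (ξ : TangentSpace I x) :
    formInChart I η x (extChartAt I x x) ![ξ] = η x ![ξ] := by
  conv_rhs => rw [← formInChart_comp_chartDeriv η (mem_extChartAt_source (I := I) x),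
    chartDeriv_self]
  rfl

theorem extD_apply_one [IsManifold I ∞ M] (η : DForm I M 1) (x : M) (v w : TangentSpace I x) :
    extD I η x ![v, w] =
      extDerivWithin (formInChart I η x) (Set.range I) (extChartAt I x x) ![v, w] := by
  rw [extD, chartDeriv_self]
  rfl

theorem extD_smul_apply [IsManifold I ∞ M] {f : M → ℝ} (hf : ContMDiff I 𝓘(ℝ, ℝ) ∞ f)
    {η : DForm I M 1} (hη : SmoothForm I η) (x : M) (v w : TangentSpace I x) :
    extD I (fun x => f x • η x) x ![v, w] =
      differential I f x v * η x ![w] - differential I f x w * η x ![v] +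
        f x * extD I η x ![v, w] := by
  have hx := mem_extChartAt_target (I := I) x
  have hu := uniqueDiffWithinAt_range hx
  have hfd : DifferentiableWithinAt ℝ (f ∘ (extChartAt I x).symm) (Set.range I)
      (extChartAt I x x) :=
    ((contDiffOn_comp_extChartAt_symm hf x _ hx).mono_of_mem_nhdsWithin
      (extChartAt_target_mem_nhdsWithin_of_mem hx)).differentiableWithinAt (by simp)
  have hfx : (f ∘ (extChartAt I x).symm) (extChartAt I x x) = f x := by simp
  rw [extD_apply_one, extD_apply_one, ← formInChart_self_apply_one η,
    ← formInChart_self_apply_one η, differential_eq_fderivWithin (hf.mdifferentiableAt (by simp)), ← hfx]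
  exact extDerivWithin_smul_oneForm_apply hu hfd (hη.differentiableWithinAt hx) v w

end FormCalculus

section PlaneAlgebra

theorem euclidean_two_eq (v : EuclideanSpace ℝ (Fin 2)) :
    v = v 0 • EuclideanSpace.single 0 1 + v 1 • EuclideanSpace.single 1 1 := by
  ext i
  fin_cases i <;> simp

theorem twoForm_apply_plane (φ : EuclideanSpace ℝ (Fin 2) [⋀^Fin 2]→L[ℝ] ℝ)
    (v w : EuclideanSpace ℝ (Fin 2)) :
    φ ![v, w] = (v 0 * w 1 - v 1 * w 0) *
      φ ![EuclideanSpace.single 0 1, EuclideanSpace.single 1 1] := by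
  conv_lhs => rw [euclidean_two_eq v, euclidean_two_eq w]
  rw [twoForm_add_left, twoForm_smul_left, twoForm_smul_left, twoForm_add_right,
    twoForm_add_right, twoForm_smul_right, twoForm_smul_right, twoForm_smul_right,
    twoForm_smul_right, twoForm_self, twoForm_self, twoForm_swap φ (EuclideanSpace.single 1 1)]
  ring

theorem det_plane (L : EuclideanSpace ℝ (Fin 2) →L[ℝ] EuclideanSpace ℝ (Fin 2)) :
    L.det = L (EuclideanSpace.single 0 1) 0 * L (EuclideanSpace.single 1 1) 1 -
      L (EuclideanSpace.single 0 1) 1 * L (EuclideanSpace.single 1 1) 0 := by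
  have h := LinearMap.det_toMatrix (EuclideanSpace.basisFun (Fin 2) ℝ).toBasis
    (L : EuclideanSpace ℝ (Fin 2) →ₗ[ℝ] EuclideanSpace ℝ (Fin 2))
  rw [ContinuousLinearMap.det, ← h, Matrix.det_fin_two]
  simp [LinearMap.toMatrix_apply]
  ring

theorem apply_plane (A : EuclideanSpace ℝ (Fin 2) →L[ℝ] EuclideanSpace ℝ (Fin 2))
    (v : EuclideanSpace ℝ (Fin 2)) (i : Fin 2) :
    A v i = v 0 * A (EuclideanSpace.single 0 1) i + v 1 * A (EuclideanSpace.single 1 1) i := by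
  conv_lhs => rw [euclidean_two_eq v]
  simp

variable {A : EuclideanSpace ℝ (Fin 2) →L[ℝ] EuclideanSpace ℝ (Fin 2)}

theorem complexStructure_plane_identities (hA : ∀ v, A (A v) = -v) :
    A (EuclideanSpace.single 0 1) 0 ^ 2 +
        A (EuclideanSpace.single 0 1) 1 * A (EuclideanSpace.single 1 1) 0 = -1 ∧
      A (EuclideanSpace.single 0 1) 1 ≠ 0 ∧
      A (EuclideanSpace.single 1 1) 1 = -A (EuclideanSpace.single 0 1) 0 := by
  have h0 := congrArg (fun v : EuclideanSpace ℝ (Fin 2) => v 0) (hA (EuclideanSpace.single 0 1))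
  have h1 := congrArg (fun v : EuclideanSpace ℝ (Fin 2) => v 1) (hA (EuclideanSpace.single 0 1))
  simp only [apply_plane A (A (EuclideanSpace.single 0 1))] at h0 h1
  simp at h0 h1
  have hne : A (EuclideanSpace.single 0 1) 1 ≠ 0 := by
    intro h
    rw [h] at h0
    nlinarith [sq_nonneg (A (EuclideanSpace.single 0 1) 0)]
  refine ⟨by linarith, hne, ?_⟩
  apply mul_left_cancel₀ hne
  linarith

/-- For a complex structure on the plane, `v ∧ A v` is a definite quadratic form. -/
theorem complexStructure_plane_pos (hA : ∀ v, A (A v) = -v) {v : EuclideanSpace ℝ (Fin 2)}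
    (hv : v ≠ 0) :
    0 < A (EuclideanSpace.single 0 1) 1 * (v 0 * A v 1 - v 1 * A v 0) := by
  obtain ⟨h1, hc, hd⟩ := complexStructure_plane_identities hA
  rw [apply_plane A v 0, apply_plane A v 1, hd]
  generalize A (EuclideanSpace.single 0 1) 1 = c at *
  generalize A (EuclideanSpace.single 0 1) 0 = a at *
  generalize A (EuclideanSpace.single 1 1) 0 = b at *
  have key : c * (v 0 * (v 0 * c + v 1 * -a) - v 1 * (v 0 * a + v 1 * b)) =
      (c * v 0 - a * v 1) ^ 2 + v 1 ^ 2 := by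
    linear_combination (-(v 1) ^ 2) * h1
  rw [key]
  by_cases h : v 1 = 0
  · have h0 : v 0 ≠ 0 := by
      intro h0
      apply hv
      ext i
      fin_cases i <;> simp [h0, h]
    rw [h, mul_zero, sub_zero]
    have := sq_pos_of_ne_zero (mul_ne_zero hc h0)
    positivity
  · positivity

end PlaneAlgebra

section ChartIntegral

variable {S : Type*} [TopologicalSpace S] [ChartedSpace (EuclideanHalfSpace 2) S]
  {j : ∀ z : S, TangentSpace (𝓡∂ 2) z →L[ℝ] TangentSpace (𝓡∂ 2) z}

theorem endoInChart_sq [IsManifold (𝓡∂ 2) ∞ S] (hj : IsComplexStructure (𝓡∂ 2) j) {i : S}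
    {y : EuclideanSpace ℝ (Fin 2)} (hy : y ∈ (extChartAt (𝓡∂ 2) i).target)
    (v : EuclideanSpace ℝ (Fin 2)) :
    endoInChart (𝓡∂ 2) j i y (endoInChart (𝓡∂ 2) j i y v) = -v := by
  change chartDeriv (𝓡∂ 2) i _ (j _ (chartSymmDeriv (𝓡∂ 2) i y (chartDeriv (𝓡∂ 2) i _ (j _
    (chartSymmDeriv (𝓡∂ 2) i y v))))) = -v
  rw [chartSymmDeriv_chartDeriv hy, hj.sq, map_neg, chartDeriv_chartSymmDeriv hy]

theorem chartSymmDeriv_endoInChart [IsManifold (𝓡∂ 2) ∞ S] {i : S}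
    {y : EuclideanSpace ℝ (Fin 2)} (hy : y ∈ (extChartAt (𝓡∂ 2) i).target)
    (v : EuclideanSpace ℝ (Fin 2)) :
    chartSymmDeriv (𝓡∂ 2) i y (endoInChart (𝓡∂ 2) j i y v) =
      j _ (chartSymmDeriv (𝓡∂ 2) i y v) :=
  chartSymmDeriv_chartDeriv hy _

theorem endoInChart_chartDeriv [IsManifold (𝓡∂ 2) ∞ S] {i z : S}
    (hz : z ∈ (extChartAt (𝓡∂ 2) i).source) (v : TangentSpace (𝓡∂ 2) z) :
    endoInChart (𝓡∂ 2) j i (extChartAt (𝓡∂ 2) i z) (chartDeriv (𝓡∂ 2) i z v) =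
      chartDeriv (𝓡∂ 2) i z (j z v) := by
  obtain ⟨y, hy, rfl⟩ : ∃ y ∈ (extChartAt (𝓡∂ 2) i).target, (extChartAt (𝓡∂ 2) i).symm y = z :=
    ⟨_, (extChartAt (𝓡∂ 2) i).map_source hz, (extChartAt (𝓡∂ 2) i).left_inv hz⟩
  rw [(extChartAt (𝓡∂ 2) i).right_inv hy]
  change chartDeriv (𝓡∂ 2) i _ (j _ (chartSymmDeriv (𝓡∂ 2) i y _)) = _
  rw [chartSymmDeriv_chartDeriv hy]

theorem chartDeriv_injective [IsManifold (𝓡∂ 2) ∞ S] {i z : S}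
    (hz : z ∈ (extChartAt (𝓡∂ 2) i).source) : Function.Injective (chartDeriv (𝓡∂ 2) i z) := by
  have : IsManifold (𝓡∂ 2) 1 S := .of_le (n := ∞) (by simp)
  exact (isInvertible_mfderiv_extChartAt hz).injective

theorem chartSymmDeriv_injective [IsManifold (𝓡∂ 2) ∞ S] {i : S} {y : EuclideanSpace ℝ (Fin 2)}
    (hy : y ∈ (extChartAt (𝓡∂ 2) i).target) :
    Function.Injective (chartSymmDeriv (𝓡∂ 2) i y) :=
  Function.LeftInverse.injective (chartDeriv_chartSymmDeriv hy)

theorem chartSign_mul_pos [IsManifold (𝓡∂ 2) ∞ S] (hj : IsComplexStructure (𝓡∂ 2) j) {i : S}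
    {y : EuclideanSpace ℝ (Fin 2)} (hy : y ∈ (extChartAt (𝓡∂ 2) i).target) :
    0 < chartSign j i y * endoInChart (𝓡∂ 2) j i y (EuclideanSpace.single 0 1) 1 := by
  have h := (complexStructure_plane_identities (endoInChart_sq hj hy)).2.1
  rw [chartSign]
  rcases lt_or_gt_of_ne h with h | h
  · rw [sign_neg h]; simpa using h
  · rw [sign_pos h]; simpa using h

theorem chartSign_eq_or [IsManifold (𝓡∂ 2) ∞ S] (hj : IsComplexStructure (𝓡∂ 2) j) {i : S}
    {y : EuclideanSpace ℝ (Fin 2)} (hy : y ∈ (extChartAt (𝓡∂ 2) i).target) :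
    chartSign j i y = 1 ∨ chartSign j i y = -1 := by
  have h := (complexStructure_plane_identities (endoInChart_sq hj hy)).2.1
  rw [chartSign]
  rcases lt_or_gt_of_ne h with h | h
  · rw [sign_neg h]; simp
  · rw [sign_pos h]; simp

/-- The sign of a chart is locally constant on its domain. -/
theorem chartSign_eventuallyEq [IsManifold (𝓡∂ 2) ∞ S] (hj : IsComplexStructure (𝓡∂ 2) j) {i : S}
    {y : EuclideanSpace ℝ (Fin 2)} (hy : y ∈ (extChartAt (𝓡∂ 2) i).target) :
    ∀ᶠ y' in 𝓝[(extChartAt (𝓡∂ 2) i).target] y, chartSign j i y' = chartSign j i y := by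
  have hc : ContinuousWithinAt
      (fun y' => endoInChart (𝓡∂ 2) j i y' (EuclideanSpace.single 0 1) 1)
      (extChartAt (𝓡∂ 2) i).target y := by
    have h1 := ((hj.smooth i).continuousOn y hy).clm_apply
      (continuousWithinAt_const (b := (EuclideanSpace.single 0 1 : EuclideanSpace ℝ (Fin 2))))
    exact (EuclideanSpace.proj (𝕜 := ℝ) (1 : Fin 2)).continuous.continuousAt.comp_continuousWithinAt
      h1
  have h := (complexStructure_plane_identities (endoInChart_sq hj hy)).2.1
  rcases lt_or_gt_of_ne h with h | h
  · filter_upwards [hc.eventually_lt_const h] with y' hy'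
    rw [chartSign, chartSign, sign_neg h, sign_neg hy']
  · filter_upwards [hc.eventually_const_lt h] with y' hy'
    rw [chartSign, chartSign, sign_pos h, sign_pos hy']

theorem continuousOn_chartSign [IsManifold (𝓡∂ 2) ∞ S] (hj : IsComplexStructure (𝓡∂ 2) j) (i : S) :
    ContinuousOn (chartSign j i) (extChartAt (𝓡∂ 2) i).target := fun _ hy =>
  (continuousWithinAt_const.congr_of_eventuallyEq (chartSign_eventuallyEq hj hy) rfl)

/-- The integral of a `2`-form over the domain of a chart. -/
def chartIntegral (j : ∀ z : S, TangentSpace (𝓡∂ 2) z →L[ℝ] TangentSpace (𝓡∂ 2) z) (i : S)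
    (η : DForm (𝓡∂ 2) S 2) : ℝ :=
  ∫ y in (extChartAt (𝓡∂ 2) i).target, chartSign j i y *
    formInChart (𝓡∂ 2) η i y ![EuclideanSpace.single 0 1, EuclideanSpace.single 1 1]

theorem measurableSet_extChartAt_target (i : S) :
    MeasurableSet (extChartAt (𝓡∂ 2) i).target := by
  rw [extChartAt_target]
  exact ((chartAt (EuclideanHalfSpace 2) i).open_target.preimage
    (𝓡∂ 2).continuous_symm).measurableSet.inter (𝓡∂ 2).isClosed_range.measurableSet

theorem continuousOn_chartIntegrand [IsManifold (𝓡∂ 2) ∞ S] (hj : IsComplexStructure (𝓡∂ 2) j)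
    {η : DForm (𝓡∂ 2) S 2} (hη : SmoothForm (𝓡∂ 2) η) (i : S) :
    ContinuousOn (fun y => chartSign j i y *
        formInChart (𝓡∂ 2) η i y ![EuclideanSpace.single 0 1, EuclideanSpace.single 1 1])
      (extChartAt (𝓡∂ 2) i).target :=
  (continuousOn_chartSign hj i).mul <|
    (ContinuousAlternatingMap.apply ℝ (EuclideanSpace ℝ (Fin 2)) ℝ _).continuous.comp_continuousOn
      (hη i).continuousOn

theorem formInChart_eq_zero {k : ℕ} {η : DForm (𝓡∂ 2) S k} {i : S} {y : EuclideanSpace ℝ (Fin 2)}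
    (h : η ((extChartAt (𝓡∂ 2) i).symm y) = 0) : formInChart (𝓡∂ 2) η i y = 0 := by
  ext v
  rw [formInChart, h]
  rfl

theorem isCompact_image_extChartAt {i : S} {C : Set S} (hC : IsCompact C)
    (hCi : C ⊆ (extChartAt (𝓡∂ 2) i).source) : IsCompact (extChartAt (𝓡∂ 2) i '' C) :=
  hC.image_of_continuousOn ((continuousOn_extChartAt i).mono hCi)

theorem symm_notMem_of_notMem_image {i : S} {C : Set S} {y : EuclideanSpace ℝ (Fin 2)}
    (hy : y ∈ (extChartAt (𝓡∂ 2) i).target) (hyC : y ∉ extChartAt (𝓡∂ 2) i '' C) :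
    (extChartAt (𝓡∂ 2) i).symm y ∉ C := fun h =>
  hyC ⟨_, h, (extChartAt (𝓡∂ 2) i).right_inv hy⟩

theorem integrableOn_chartIntegrand [IsManifold (𝓡∂ 2) ∞ S] (hj : IsComplexStructure (𝓡∂ 2) j)
    {η : DForm (𝓡∂ 2) S 2} (hη : SmoothForm (𝓡∂ 2) η) {i : S} {C : Set S} (hC : IsCompact C)
    (hCi : C ⊆ (extChartAt (𝓡∂ 2) i).source) (hηC : ∀ z ∉ C, η z = 0) :
    MeasureTheory.IntegrableOn (fun y => chartSign j i y *
        formInChart (𝓡∂ 2) η i y ![EuclideanSpace.single 0 1, EuclideanSpace.single 1 1])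
      (extChartAt (𝓡∂ 2) i).target := by
  have hsub : extChartAt (𝓡∂ 2) i '' C ⊆ (extChartAt (𝓡∂ 2) i).target := by
    rintro _ ⟨z, hz, rfl⟩
    exact (extChartAt (𝓡∂ 2) i).map_source (hCi hz)
  refine MeasureTheory.IntegrableOn.of_forall_sdiff_eq_zero
    (((continuousOn_chartIntegrand hj hη i).mono hsub).integrableOn_compact
      (isCompact_image_extChartAt hC hCi)) (measurableSet_extChartAt_target i) ?_
  rintro y ⟨hy, hyC⟩
  rw [formInChart_eq_zero (hηC _ (symm_notMem_of_notMem_image hy hyC))]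
  simp

/-- The integral of a form supported in two charts can be computed in either of them. -/
theorem chartIntegral_eq_of_support [IsManifold (𝓡∂ 2) ∞ S] (hj : IsComplexStructure (𝓡∂ 2) j)
    {η : DForm (𝓡∂ 2) S 2} {i k : S} (hi : ∀ z ∉ (extChartAt (𝓡∂ 2) i).source, η z = 0)
    (hk : ∀ z ∉ (extChartAt (𝓡∂ 2) k).source, η z = 0) :
    chartIntegral j i η = chartIntegral j k η := by
  set φ := extChartAt (𝓡∂ 2) i with hφ
  set ψ := extChartAt (𝓡∂ 2) k with hψ
  have hmeas : ∀ a b : S, MeasurableSet ((extChartAt (𝓡∂ 2) a).target ∩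
      (extChartAt (𝓡∂ 2) a).symm ⁻¹' (extChartAt (𝓡∂ 2) b).source) := by
    intro a b
    obtain ⟨O, hO, hOe⟩ := (continuousOn_iff'.1 (continuousOn_extChartAt_symm (I := 𝓡∂ 2) a)) _
      (isOpen_extChartAt_source (I := 𝓡∂ 2) b)
    rw [Set.inter_comm, hOe]
    exact hO.measurableSet.inter (measurableSet_extChartAt_target a)
  have hred : ∀ a b : S, (∀ z ∉ (extChartAt (𝓡∂ 2) b).source, η z = 0) → chartIntegral j a η =
      ∫ y in (extChartAt (𝓡∂ 2) a).target ∩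
          (extChartAt (𝓡∂ 2) a).symm ⁻¹' (extChartAt (𝓡∂ 2) b).source, chartSign j a y *
        formInChart (𝓡∂ 2) η a y ![EuclideanSpace.single 0 1, EuclideanSpace.single 1 1] := by
    intro a b hb
    rw [chartIntegral]
    refine (MeasureTheory.setIntegral_eq_of_subset_of_forall_sdiff_eq_zero
      (measurableSet_extChartAt_target a) Set.inter_subset_left ?_)
    rintro y ⟨hy, hyb⟩
    rw [formInChart_eq_zero (hb _ fun h => hyb ⟨hy, h⟩)]
    simp
  rw [hred i k hk, hred k i hi]
  have himage : ψ.target ∩ ψ.symm ⁻¹' φ.source =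
      (ψ ∘ φ.symm) '' (φ.target ∩ φ.symm ⁻¹' ψ.source) := by
    ext y
    constructor
    · rintro ⟨hy, hyφ⟩
      refine ⟨φ (ψ.symm y), ⟨φ.map_source hyφ, ?_⟩, ?_⟩
      · change φ.symm (φ (ψ.symm y)) ∈ ψ.source
        rw [φ.left_inv hyφ]
        exact ψ.map_target hy
      · change ψ (φ.symm (φ (ψ.symm y))) = y
        rw [φ.left_inv hyφ, ψ.right_inv hy]
    · rintro ⟨x, ⟨hx, hxψ⟩, rfl⟩
      refine ⟨ψ.map_source hxψ, ?_⟩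
      change ψ.symm (ψ (φ.symm x)) ∈ φ.source
      rw [ψ.left_inv hxψ]
      exact φ.map_target hx
  have hderiv : ∀ x ∈ φ.target ∩ φ.symm ⁻¹' ψ.source, HasFDerivWithinAt (ψ ∘ φ.symm)
      (chartDeriv (𝓡∂ 2) k (φ.symm x) ∘L chartSymmDeriv (𝓡∂ 2) i x)
      (φ.target ∩ φ.symm ⁻¹' ψ.source) x := by
    rintro x ⟨hx, hxψ⟩
    have h := hasFDerivWithinAt_inCharts (I' := 𝓡∂ 2) (f := (id : S → S)) hx mdifferentiableAt_id hxψ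
    rw [mfderiv_id] at h
    exact h.mono (Set.inter_subset_left.trans (extChartAt_target_subset_range i))
  have hinj : Set.InjOn (ψ ∘ φ.symm) (φ.target ∩ φ.symm ⁻¹' ψ.source) := by
    rintro x ⟨hx, hxψ⟩ x' ⟨hx', hxψ'⟩ h
    exact φ.symm.injOn hx hx' (ψ.injOn hxψ hxψ' h)
  rw [himage, MeasureTheory.integral_image_eq_integral_abs_det_fderiv_smul _ (hmeas i k) hderiv
    hinj]
  refine MeasureTheory.setIntegral_congr_fun (hmeas i k) ?_
  rintro x ⟨hx, hxψ⟩
  set z := φ.symm x with hz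
  have hψz : ψ (φ.symm x) ∈ ψ.target := ψ.map_source hxψ
  set L := chartDeriv (𝓡∂ 2) k z ∘L chartSymmDeriv (𝓡∂ 2) i x with hL
  have hform : formInChart (𝓡∂ 2) η i x ![EuclideanSpace.single 0 1, EuclideanSpace.single 1 1] =
      L.det * formInChart (𝓡∂ 2) η k (ψ z)
        ![EuclideanSpace.single 0 1, EuclideanSpace.single 1 1] := by
    rw [formInChart_apply_two, ← formInChart_chartDeriv_apply_two η hxψ, twoForm_apply_plane,
      det_plane]
    rfl
  have hsign : 0 < chartSign j k (ψ z) * chartSign j i x * L.det := by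
    have hψt : ψ z ∈ ψ.target := hψz
    have hLne : L (EuclideanSpace.single 0 1) ≠ 0 := by
      intro h
      have h1 : chartSymmDeriv (𝓡∂ 2) i x (EuclideanSpace.single 0 1) = 0 :=
        chartDeriv_injective hxψ (h.trans (map_zero _).symm)
      have h2 := chartSymmDeriv_injective hx (h1.trans (map_zero _).symm)
      simpa using congrArg (fun v : EuclideanSpace ℝ (Fin 2) => v 0) h2
    have h1 := complexStructure_plane_pos (endoInChart_sq hj hψt) hLne
    have h2 : endoInChart (𝓡∂ 2) j k (ψ z) (L (EuclideanSpace.single 0 1)) =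
        L (endoInChart (𝓡∂ 2) j i x (EuclideanSpace.single 0 1)) := by
      refine (endoInChart_chartDeriv hxψ _).trans ?_
      change _ = chartDeriv (𝓡∂ 2) k z (chartSymmDeriv (𝓡∂ 2) i x _)
      rw [chartSymmDeriv_endoInChart hx]
      rfl
    rw [h2, apply_plane L (endoInChart _ _ _ _ _) 0, apply_plane L (endoInChart _ _ _ _ _) 1] at h1
    have h3 := chartSign_mul_pos hj hψt
    have h4 := chartSign_mul_pos hj hx
    have h5 := mul_pos (mul_pos h3 h4) h1
    have h6 : (0 : ℝ) < (endoInChart (𝓡∂ 2) j k (ψ z) (EuclideanSpace.single 0 1) 1 *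
        endoInChart (𝓡∂ 2) j i x (EuclideanSpace.single 0 1) 1) ^ 2 :=
      sq_pos_of_ne_zero (mul_ne_zero (right_ne_zero_of_mul h3.ne') (right_ne_zero_of_mul h4.ne'))
    refine pos_of_mul_pos_left ?_ h6.le
    rw [det_plane]
    calc _ < _ := h5
      _ = _ := by ring
  change chartSign j i x * _ = |L.det| • (chartSign j k (ψ z) * formInChart (𝓡∂ 2) η k (ψ z) _)
  rw [hform, smul_eq_mul]
  rcases chartSign_eq_or hj hx with h1 | h1 <;>
    rcases chartSign_eq_or hj (show ψ z ∈ ψ.target from hψz) with h2 | h2 <;>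
    rw [h1, h2] at hsign ⊢
  · rw [abs_of_pos (by linarith)]; ring
  · rw [abs_of_neg (by linarith)]; ring
  · rw [abs_of_neg (by linarith)]; ring
  · rw [abs_of_pos (by linarith)]; ring

theorem chartIntegral_sum (i : S) {ι : Type*} (s : Finset ι) (η : ι → DForm (𝓡∂ 2) S 2)
    (hη : ∀ a ∈ s, MeasureTheory.IntegrableOn (fun y => chartSign j i y *
      formInChart (𝓡∂ 2) (η a) i y ![EuclideanSpace.single 0 1, EuclideanSpace.single 1 1])
        (extChartAt (𝓡∂ 2) i).target) :
    chartIntegral j i (∑ a ∈ s, η a) = ∑ a ∈ s, chartIntegral j i (η a) := by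
  simp only [chartIntegral]
  rw [← MeasureTheory.integral_finsetSum _ hη]
  congr 1
  funext y
  rw [← Finset.mul_sum]
  congr 1
  simp only [formInChart, Finset.sum_apply,
    ContinuousAlternatingMap.compContinuousLinearMap_apply, ContinuousAlternatingMap.sum_apply]

theorem extD_eq_zero_of_eventuallyEq {k : ℕ} {η : DForm (𝓡∂ 2) S k} {z : S}
    (h : ∀ᶠ z' in 𝓝 z, η z' = 0) : extD (𝓡∂ 2) η z = 0 := by
  have h1 : formInChart (𝓡∂ 2) η z =ᶠ[𝓝 (extChartAt (𝓡∂ 2) z z)]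
      formInChart (𝓡∂ 2) (0 : DForm (𝓡∂ 2) S k) z := by
    have h2 := (continuousAt_extChartAt_symm (I := 𝓡∂ 2) z).eventually
      (by rwa [extChartAt_to_inv] : ∀ᶠ z' in 𝓝 ((extChartAt (𝓡∂ 2) z).symm (extChartAt (𝓡∂ 2) z z)),
        η z' = 0)
    filter_upwards [h2] with y hy
    rw [formInChart_eq_zero hy, formInChart_eq_zero rfl]
  have h3 : extD (𝓡∂ 2) η z = extD (𝓡∂ 2) (0 : DForm (𝓡∂ 2) S k) z := by
    rw [extD, extD, h1.extDerivWithin_eq_nhds]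
  rw [h3, extD_zero]
  rfl

theorem chartSign_mul_nonneg [IsManifold (𝓡∂ 2) ∞ S] (hj : IsComplexStructure (𝓡∂ 2) j) {η : DForm (𝓡∂ 2) S 2}
    {i : S} {y : EuclideanSpace ℝ (Fin 2)} (hy : y ∈ (extChartAt (𝓡∂ 2) i).target)
    (hη : ∀ ξ, 0 ≤ η ((extChartAt (𝓡∂ 2) i).symm y) ![ξ, j _ ξ]) :
    0 ≤ chartSign j i y *
      formInChart (𝓡∂ 2) η i y ![EuclideanSpace.single 0 1, EuclideanSpace.single 1 1] := by
  have h1 := hη (chartSymmDeriv (𝓡∂ 2) i y (EuclideanSpace.single 0 1))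
  rw [← chartSymmDeriv_endoInChart hy, ← formInChart_apply_two, twoForm_apply_plane] at h1
  have h2 := chartSign_mul_pos hj hy
  simp at h1
  set c := endoInChart (𝓡∂ 2) j i y (EuclideanSpace.single 0 1) 1
  set F := formInChart (𝓡∂ 2) η i y ![EuclideanSpace.single 0 1, EuclideanSpace.single 1 1]
  rcases chartSign_eq_or hj hy with h | h <;> rw [h] at h2 ⊢
  · rw [one_mul] at h2 ⊢
    exact nonneg_of_mul_nonneg_right h1 h2
  · have : 0 ≤ (-1 * c) * (-1 * F) := by linarith
    exact nonneg_of_mul_nonneg_right this h2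

end ChartIntegral

section SurfaceIntegral

variable {S : Type*} [TopologicalSpace S] [ChartedSpace (EuclideanHalfSpace 2) S]
  [IsManifold (𝓡∂ 2) ∞ S] [T2Space S] [CompactSpace S]
  {j : ∀ z : S, TangentSpace (𝓡∂ 2) z →L[ℝ] TangentSpace (𝓡∂ 2) z}

theorem tsupport_chartPartition_subset (i : S) :
    tsupport (chartPartition S i) ⊆ (extChartAt (𝓡∂ 2) i).source := by
  rw [extChartAt_source]
  exact (SmoothPartitionOfUnity.exists_isSubordinate_chartAt_source (𝓡∂ 2) S).choose_spec i

theorem finite_support_chartPartition :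
    {i : S | (Function.support (chartPartition S i)).Nonempty}.Finite :=
  (chartPartition S).locallyFinite.finite_nonempty_of_compact

variable (S) in
/-- The indices of the non-zero members of the partition of unity. -/
def partitionIndices : Finset S := (finite_support_chartPartition (S := S)).toFinset

theorem chartPartition_eq_zero {i : S} (hi : i ∉ partitionIndices S) (z : S) :
    chartPartition S i z = 0 := by
  by_contra h
  exact hi ((Set.Finite.mem_toFinset _).2 ⟨z, h⟩)

theorem sum_chartPartition (z : S) : ∑ i ∈ partitionIndices S, chartPartition S i z = 1 := by
  rw [← (chartPartition S).sum_eq_one (Set.mem_univ z)]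
  refine (finsum_eq_sum_of_support_subset _ fun i hi => ?_).symm
  by_contra h
  exact hi (chartPartition_eq_zero h z)

/-- The part of a form that is carried by one chart. -/
def localPart {k : ℕ} (i : S) (η : DForm (𝓡∂ 2) S k) : DForm (𝓡∂ 2) S k :=
  fun z => chartPartition S i z • η z

theorem SmoothForm.localPart {k : ℕ} {η : DForm (𝓡∂ 2) S k} (hη : SmoothForm (𝓡∂ 2) η) (i : S) :
    SmoothForm (𝓡∂ 2) (localPart i η) :=
  hη.smul (chartPartition S i).contMDiff

theorem localPart_eq_zero {k : ℕ} {η : DForm (𝓡∂ 2) S k} {i z : S}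
    (hz : z ∉ tsupport (chartPartition S i)) : localPart i η z = 0 := by
  rw [FloerPositivity.localPart, image_eq_zero_of_notMem_tsupport hz]
  exact zero_smul ℝ (η z)

theorem localPart_eq_zero_of_eq_zero {k : ℕ} {η : DForm (𝓡∂ 2) S k} {i z : S}
    (hz : η z = 0) : localPart i η z = 0 := by
  rw [FloerPositivity.localPart, hz]
  exact smul_zero _

theorem sum_localPart {k : ℕ} (η : DForm (𝓡∂ 2) S k) :
    ∑ i ∈ partitionIndices S, localPart i η = η := by
  funext z
  rw [Finset.sum_apply]
  ext v
  simp only [FloerPositivity.localPart, ContinuousAlternatingMap.sum_apply,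
    ContinuousAlternatingMap.smul_apply, smul_eq_mul]
  rw [← Finset.sum_mul, sum_chartPartition, one_mul]

theorem chartIntegral_localPart (i : S) (η : DForm (𝓡∂ 2) S 2) :
    chartIntegral j i (localPart i η) = ∫ y in (extChartAt (𝓡∂ 2) i).target,
    chartPartition S i ((extChartAt (𝓡∂ 2) i).symm y) * (chartSign j i y *
      formInChart (𝓡∂ 2) η i y ![EuclideanSpace.single 0 1, EuclideanSpace.single 1 1]) := by
  rw [chartIntegral]
  congr 1
  funext y
  exact mul_left_comm (chartSign j i y) (chartPartition S i ((extChartAt (𝓡∂ 2) i).symm y))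
    (formInChart (𝓡∂ 2) η i y _)

theorem surfaceIntegral_eq_sum (η : DForm (𝓡∂ 2) S 2) :
    surfaceIntegral j η = ∑ i ∈ partitionIndices S, chartIntegral j i (localPart i η) := by
  simp only [chartIntegral_localPart]
  refine finsum_eq_sum_of_support_subset _ fun i hi => ?_
  by_contra h
  exact hi (by simp [chartPartition_eq_zero h])

theorem integrableOn_localPart (hj : IsComplexStructure (𝓡∂ 2) j) {η : DForm (𝓡∂ 2) S 2}
    (hη : SmoothForm (𝓡∂ 2) η) (i : S) :
    MeasureTheory.IntegrableOn (fun y => chartSign j i y * formInChart (𝓡∂ 2) (localPart i η) i y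
      ![EuclideanSpace.single 0 1, EuclideanSpace.single 1 1]) (extChartAt (𝓡∂ 2) i).target :=
  integrableOn_chartIntegrand hj (hη.localPart i) (isClosed_tsupport _).isCompact
    (tsupport_chartPartition_subset i) fun _ => localPart_eq_zero

theorem surfaceIntegral_sum (hj : IsComplexStructure (𝓡∂ 2) j) {ι : Type*} (s : Finset ι)
    {η : ι → DForm (𝓡∂ 2) S 2} (hη : ∀ a ∈ s, SmoothForm (𝓡∂ 2) (η a)) :
    surfaceIntegral j (∑ a ∈ s, η a) = ∑ a ∈ s, surfaceIntegral j (η a) := by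
  simp only [surfaceIntegral_eq_sum]
  rw [Finset.sum_comm]
  refine Finset.sum_congr rfl fun i _ => ?_
  rw [← chartIntegral_sum i s _ fun a ha => integrableOn_localPart hj (hη a ha) i]
  congr 1
  funext z
  simp only [FloerPositivity.localPart, Finset.sum_apply, Finset.smul_sum]

theorem surfaceIntegral_add (hj : IsComplexStructure (𝓡∂ 2) j) {η η' : DForm (𝓡∂ 2) S 2}
    (hη : SmoothForm (𝓡∂ 2) η) (hη' : SmoothForm (𝓡∂ 2) η') :
    surfaceIntegral j (fun z => η z + η' z) = surfaceIntegral j η + surfaceIntegral j η' := by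
  have h := surfaceIntegral_sum hj (Finset.univ : Finset (Fin 2)) (η := ![η, η']) (by
    intro a _
    fin_cases a
    · exact hη
    · exact hη')
  rw [Fin.sum_univ_two, Fin.sum_univ_two] at h
  exact h

/-- The integral of a form supported in a chart can be computed in that chart. -/
theorem surfaceIntegral_eq_chartIntegral (hj : IsComplexStructure (𝓡∂ 2) j)
    {η : DForm (𝓡∂ 2) S 2} (hη : SmoothForm (𝓡∂ 2) η) {i : S} {C : Set S} (hC : IsCompact C)
    (hCi : C ⊆ (extChartAt (𝓡∂ 2) i).source) (hηC : ∀ z ∉ C, η z = 0) :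
    surfaceIntegral j η = chartIntegral j i η := by
  conv_rhs => rw [← sum_localPart η]
  rw [chartIntegral_sum i _ _ fun a _ => integrableOn_chartIntegrand hj (hη.localPart a) hC hCi
    fun z hz => localPart_eq_zero_of_eq_zero (hηC z hz), surfaceIntegral_eq_sum]
  refine Finset.sum_congr rfl fun k _ => ?_
  exact chartIntegral_eq_of_support hj
    (fun z hz => localPart_eq_zero fun h => hz (tsupport_chartPartition_subset k h))
    (fun z hz => localPart_eq_zero_of_eq_zero (hηC z fun h => hz (hCi h)))

theorem localPart_nonneg {η : DForm (𝓡∂ 2) S 2} (hη : ∀ z ξ, 0 ≤ η z ![ξ, j z ξ]) (i z : S)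
    (ξ : TangentSpace (𝓡∂ 2) z) : 0 ≤ localPart i η z ![ξ, j z ξ] :=
  mul_nonneg ((chartPartition S).nonneg i z) (hη z ξ)

theorem chartIntegral_localPart_nonneg (hj : IsComplexStructure (𝓡∂ 2) j) {η : DForm (𝓡∂ 2) S 2}
    (hη : ∀ z ξ, 0 ≤ η z ![ξ, j z ξ]) (i : S) : 0 ≤ chartIntegral j i (localPart i η) :=
  MeasureTheory.setIntegral_nonneg (measurableSet_extChartAt_target i) fun _ hy =>
    chartSign_mul_nonneg hj hy (localPart_nonneg hη i _)

theorem surfaceIntegral_nonneg (hj : IsComplexStructure (𝓡∂ 2) j) {η : DForm (𝓡∂ 2) S 2}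
    (hη : ∀ z ξ, 0 ≤ η z ![ξ, j z ξ]) : 0 ≤ surfaceIntegral j η := by
  rw [surfaceIntegral_eq_sum]
  exact Finset.sum_nonneg fun i _ => chartIntegral_localPart_nonneg hj hη i

/-- A non-negative smooth form with vanishing integral is zero. -/
theorem eq_zero_of_surfaceIntegral_eq_zero (hj : IsComplexStructure (𝓡∂ 2) j)
    {η : DForm (𝓡∂ 2) S 2} (hηs : SmoothForm (𝓡∂ 2) η) (hη : ∀ z ξ, 0 ≤ η z ![ξ, j z ξ])
    (h0 : surfaceIntegral j η = 0) (z : S) (v w : TangentSpace (𝓡∂ 2) z) : η z ![v, w] = 0 := by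
  rw [surfaceIntegral_eq_sum,
    Finset.sum_eq_zero_iff_of_nonneg fun i _ => chartIntegral_localPart_nonneg hj hη i] at h0
  obtain ⟨i, hi, hiz⟩ : ∃ i ∈ partitionIndices S, chartPartition S i z ≠ 0 := by
    by_contra! h
    have := sum_chartPartition z
    rw [Finset.sum_eq_zero h] at this
    exact zero_ne_one this
  have hzi : z ∈ (extChartAt (𝓡∂ 2) i).source :=
    tsupport_chartPartition_subset i (subset_tsupport _ hiz)
  have hae := (MeasureTheory.setIntegral_eq_zero_iff_of_nonneg_ae
    ((MeasureTheory.ae_restrict_iff' (measurableSet_extChartAt_target i)).2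
      (Filter.Eventually.of_forall fun y hy =>
        chartSign_mul_nonneg hj hy (localPart_nonneg hη i _)))
    (integrableOn_localPart hj hηs i)).1 (h0 i hi)
  have heq := MeasureTheory.Measure.eqOn_of_ae_eq hae
    (continuousOn_chartIntegrand hj (hηs.localPart i) i) continuousOn_const
    (extChartAt_target_subset_closure_interior)
  have hy := heq ((extChartAt (𝓡∂ 2) i).map_source hzi)
  have hs : chartSign j i (extChartAt (𝓡∂ 2) i z) ≠ 0 := by
    rcases chartSign_eq_or hj ((extChartAt (𝓡∂ 2) i).map_source hzi) with h | h <;> rw [h] <;> simp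
  have hF : formInChart (𝓡∂ 2) (localPart i η) i (extChartAt (𝓡∂ 2) i z)
      ![EuclideanSpace.single 0 1, EuclideanSpace.single 1 1] = 0 :=
    (mul_eq_zero.1 hy).resolve_left hs
  have h1 : localPart i η z ![v, w] = 0 := by
    rw [← formInChart_chartDeriv_apply_two _ hzi, twoForm_apply_plane, hF, mul_zero]
  exact (mul_eq_zero.1 h1).resolve_left hiz

end SurfaceIntegral

section HalfPlane

/-- The identification of `ℝ × ℝ` with the Euclidean plane. -/
def planeEquiv : (ℝ × ℝ) ≃L[ℝ] EuclideanSpace ℝ (Fin 2) :=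
  (ContinuousLinearEquiv.finTwoArrow ℝ ℝ).symm.trans (EuclideanSpace.equiv (Fin 2) ℝ).symm

theorem planeEquiv_apply (p : ℝ × ℝ) : planeEquiv p = !₂[p.1, p.2] := rfl

theorem planeEquiv_fst : planeEquiv (1, 0) = EuclideanSpace.single 0 1 := by
  ext i
  fin_cases i <;> simp [planeEquiv_apply]

theorem planeEquiv_snd : planeEquiv (0, 1) = EuclideanSpace.single 1 1 := by
  ext i
  fin_cases i <;> simp [planeEquiv_apply]

theorem measurePreserving_planeEquiv : MeasureTheory.MeasurePreserving planeEquiv :=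
  (PiLp.volume_preserving_toLp (Fin 2)).comp (MeasureTheory.volume_preserving_finTwoArrow ℝ).symm

theorem continuous_boundaryLine : Continuous fun t : ℝ => !₂[(0 : ℝ), t] :=
  planeEquiv.continuous.comp (Continuous.prodMk_right (0 : ℝ) (Y := ℝ))

theorem mem_range_halfPlane {y : EuclideanSpace ℝ (Fin 2)} :
    y ∈ Set.range (𝓡∂ 2) ↔ 0 ≤ y 0 := by
  rw [range_modelWithCornersEuclideanHalfSpace]
  rfl

/-- Stokes' theorem on the half-plane. -/
theorem integral_halfPlane {G : EuclideanSpace ℝ (Fin 2) → EuclideanSpace ℝ (Fin 2) [⋀^Fin 1]→L[ℝ] ℝ}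
    {D : EuclideanSpace ℝ (Fin 2) →
      EuclideanSpace ℝ (Fin 2) →L[ℝ] EuclideanSpace ℝ (Fin 2) [⋀^Fin 1]→L[ℝ] ℝ}
    {C : Set (EuclideanSpace ℝ (Fin 2))} (hC : IsCompact C) (hGC : ∀ y ∉ C, G y = 0)
    (hDC : ∀ y ∉ C, D y = 0) (hG : ContinuousOn G (Set.range (𝓡∂ 2)))
    (hD : ContinuousOn D (Set.range (𝓡∂ 2)))
    (hGD : ∀ y : EuclideanSpace ℝ (Fin 2), 0 < y 0 → HasFDerivAt G (D y) y) :
    ∫ y in Set.range (𝓡∂ 2), (D y (EuclideanSpace.single 0 1) ![EuclideanSpace.single 1 1] -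
      D y (EuclideanSpace.single 1 1) ![EuclideanSpace.single 0 1]) =
    -∫ t : ℝ, G !₂[0, t] ![EuclideanSpace.single 1 1] := by
  obtain ⟨R, hR0, hR⟩ : ∃ R : ℝ, 0 < R ∧ ∀ y ∈ C, ‖y‖ < R := by
    obtain ⟨R, hR⟩ := hC.isBounded.exists_norm_le
    exact ⟨|R| + 1, by positivity, fun y hy =>
      lt_of_le_of_lt ((hR y hy).trans (le_abs_self R)) (lt_add_one _)⟩
  have hcoord : ∀ y ∈ C, ∀ i, |y i| < R := fun y hy i =>
    lt_of_le_of_lt (PiLp.norm_apply_le y i) (hR y hy)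
  have hout1 : ∀ p : ℝ × ℝ, R ≤ |p.1| → planeEquiv p ∉ C := fun p hp h =>
    absurd (hcoord _ h 0) (by simpa [planeEquiv_apply] using hp)
  have hout2 : ∀ p : ℝ × ℝ, R ≤ |p.2| → planeEquiv p ∉ C := fun p hp h =>
    absurd (hcoord _ h 1) (by simpa [planeEquiv_apply] using hp)
  let ev : EuclideanSpace ℝ (Fin 2) → (EuclideanSpace ℝ (Fin 2) [⋀^Fin 1]→L[ℝ] ℝ) →L[ℝ] ℝ :=
    fun v => ContinuousAlternatingMap.apply ℝ (EuclideanSpace ℝ (Fin 2)) ℝ ![v]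
  let f : ℝ × ℝ → ℝ := fun p => ev (EuclideanSpace.single 1 1) (G (planeEquiv p))
  let g : ℝ × ℝ → ℝ := fun p => -ev (EuclideanSpace.single 0 1) (G (planeEquiv p))
  let f' : ℝ × ℝ → ℝ × ℝ →L[ℝ] ℝ := fun p =>
    ev (EuclideanSpace.single 1 1) ∘L D (planeEquiv p) ∘L (planeEquiv : (ℝ × ℝ) →L[ℝ] _)
  let g' : ℝ × ℝ → ℝ × ℝ →L[ℝ] ℝ := fun p =>
    -(ev (EuclideanSpace.single 0 1) ∘L D (planeEquiv p) ∘L (planeEquiv : (ℝ × ℝ) →L[ℝ] _))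
  let h : EuclideanSpace ℝ (Fin 2) → ℝ := fun y =>
    D y (EuclideanSpace.single 0 1) ![EuclideanSpace.single 1 1] -
      D y (EuclideanSpace.single 1 1) ![EuclideanSpace.single 0 1]
  have hdiv : ∀ p, f' p (1, 0) + g' p (0, 1) = h (planeEquiv p) := by
    intro p
    change D (planeEquiv p) (planeEquiv (1, 0)) ![EuclideanSpace.single 1 1] +
      -(D (planeEquiv p) (planeEquiv (0, 1)) ![EuclideanSpace.single 0 1]) = _
    rw [planeEquiv_fst, planeEquiv_snd, ← sub_eq_add_neg]
  have hmaps : Set.MapsTo planeEquiv (Set.Icc ((0, -R) : ℝ × ℝ) (R, R)) (Set.range (𝓡∂ 2)) := by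
    intro p hp
    rw [mem_range_halfPlane]
    simpa [planeEquiv_apply] using hp.1.1
  have hGe : ContinuousOn (fun p => G (planeEquiv p)) (Set.Icc ((0, -R) : ℝ × ℝ) (R, R)) :=
    hG.comp planeEquiv.continuous.continuousOn hmaps
  have hDe : ContinuousOn (fun p => D (planeEquiv p)) (Set.Icc ((0, -R) : ℝ × ℝ) (R, R)) :=
    hD.comp planeEquiv.continuous.continuousOn hmaps
  have hhe : ContinuousOn (fun p => h (planeEquiv p)) (Set.Icc ((0, -R) : ℝ × ℝ) (R, R)) := by
    refine ContinuousOn.sub ?_ ?_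
    · exact (ev (EuclideanSpace.single 1 1)).continuous.comp_continuousOn
        (hDe.clm_apply continuousOn_const)
    · exact (ev (EuclideanSpace.single 0 1)).continuous.comp_continuousOn
        (hDe.clm_apply continuousOn_const)
  have hder : ∀ p ∈ Set.Ioo (0 : ℝ) R ×ˢ Set.Ioo (-R) R,
      HasFDerivAt (fun p => G (planeEquiv p))
        (D (planeEquiv p) ∘L (planeEquiv : (ℝ × ℝ) →L[ℝ] _)) p := by
    rintro p ⟨hp, -⟩
    exact (hGD (planeEquiv p) (by simpa [planeEquiv_apply] using hp.1)).comp p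
      planeEquiv.hasFDerivAt
  have key := MeasureTheory.integral_divergence_prod_Icc_of_hasFDerivAt_of_le f g f' g' (0, -R) (R, R)
    ⟨hR0.le, by simpa using (by linarith : -R ≤ R)⟩
    ((ev _).continuous.comp_continuousOn hGe) ((ev _).continuous.comp_continuousOn hGe).neg
    (fun p hp => (ev _).hasFDerivAt.comp p (hder p hp))
    (fun p hp => ((ev _).hasFDerivAt.comp p (hder p hp)).neg)
    (by simp only [hdiv]; exact hhe.integrableOn_compact isCompact_Icc)
  simp only [hdiv] at key
  have hg0 : ∀ p : ℝ × ℝ, R ≤ |p.2| → g p = 0 := fun p hp => by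
    simp only [g]
    rw [hGC _ (hout2 p hp), map_zero, neg_zero]
  have hf0 : ∀ p : ℝ × ℝ, planeEquiv p ∉ C → f p = 0 := fun p hp => by
    simp only [f]
    rw [hGC _ hp, map_zero]
  have e1 : ∫ x in (0 : ℝ)..R, g (x, R) = 0 :=
    intervalIntegral.integral_zero_ae (Filter.Eventually.of_forall fun x _ =>
      hg0 (x, R) (le_abs_self R))
  have e2 : ∫ x in (0 : ℝ)..R, g (x, -R) = 0 :=
    intervalIntegral.integral_zero_ae (Filter.Eventually.of_forall fun x _ =>
      hg0 (x, -R) (by simpa using le_abs_self R))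
  have e3 : ∫ y in (-R)..R, f (R, y) = 0 :=
    intervalIntegral.integral_zero_ae (Filter.Eventually.of_forall fun y _ =>
      hf0 (R, y) (hout1 _ (le_abs_self R)))
  have e4 : ∫ y in (-R)..R, f (0, y) = ∫ t : ℝ, G !₂[0, t] ![EuclideanSpace.single 1 1] := by
    rw [intervalIntegral.integral_of_le (by linarith)]
    refine MeasureTheory.setIntegral_eq_integral_of_forall_compl_eq_zero fun t ht => ?_
    refine hf0 (0, t) (hout2 _ ?_)
    by_contra! hlt
    exact ht ⟨(abs_lt.1 hlt).1, (abs_lt.1 hlt).2.le⟩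
  rw [e1, e2, e3, e4] at key
  simp only [sub_self, zero_add, zero_sub] at key
  rw [← key]
  change ∫ y in Set.range (𝓡∂ 2), h y = _
  rw [← measurePreserving_planeEquiv.setIntegral_preimage_emb
    planeEquiv.toHomeomorph.measurableEmbedding]
  refine MeasureTheory.setIntegral_eq_of_subset_of_forall_sdiff_eq_zero
    (((𝓡∂ 2).isClosed_range.preimage planeEquiv.continuous).measurableSet) hmaps ?_
  rintro p ⟨hp, hpI⟩
  have hp0 : 0 ≤ p.1 := by
    have := mem_range_halfPlane.1 hp
    simpa [planeEquiv_apply] using this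
  have hpC : planeEquiv p ∉ C := by
    by_contra hpC
    apply hpI
    have h1 : |p.1| < R := by
      by_contra! h
      exact hout1 p h hpC
    have h2 : |p.2| < R := by
      by_contra! h
      exact hout2 p h hpC
    exact ⟨⟨hp0, (abs_lt.1 h2).1.le⟩, ⟨(abs_lt.1 h1).2.le, (abs_lt.1 h2).2.le⟩⟩
  simp only [h]
  rw [hDC _ hpC]
  simp

/-- A function on a relatively open set, vanishing off a closed subset of it, can be extended
by zero. -/
theorem continuousOn_indicator_of_closed {X F : Type*} [TopologicalSpace X]
    [TopologicalSpace F] [Zero F] {R T C : Set X} {f : X → F} (hC : IsClosed C) (hCT : C ⊆ T)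
    (hT : ∀ y ∈ T, T ∈ 𝓝[R] y) (hf : ContinuousOn f T) (h0 : ∀ y ∈ T, y ∉ C → f y = 0) :
    ContinuousOn (T.indicator f) R := by
  intro y _
  by_cases hy : y ∈ T
  · have h1 : ContinuousWithinAt f R y := (hf y hy).mono_of_mem_nhdsWithin (hT y hy)
    refine h1.congr_of_eventuallyEq ?_ (Set.indicator_of_mem hy f)
    filter_upwards [hT y hy] with y' hy'
    exact Set.indicator_of_mem hy' f
  · have h1 : ∀ᶠ y' in 𝓝 y, T.indicator f y' = 0 := by
      filter_upwards [hC.isOpen_compl.mem_nhds fun h => hy (hCT h)] with y' hy'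
      by_cases hyT : y' ∈ T
      · rw [Set.indicator_of_mem hyT, h0 y' hyT hy']
      · exact Set.indicator_of_notMem hyT f
    exact (continuousWithinAt_const (b := (0 : F))).congr_of_eventuallyEq
      (nhdsWithin_le_nhds h1) h1.self_of_nhds

end HalfPlane

section Stokes

variable {S : Type*} [TopologicalSpace S] [ChartedSpace (EuclideanHalfSpace 2) S]
  {j : ∀ z : S, TangentSpace (𝓡∂ 2) z →L[ℝ] TangentSpace (𝓡∂ 2) z}

/-- Stokes' theorem for a form supported in the domain of a chart. -/
theorem chartIntegral_extD [IsManifold (𝓡∂ 2) ∞ S] (hj : IsComplexStructure (𝓡∂ 2) j)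
    {η : DForm (𝓡∂ 2) S 1} (hη : SmoothForm (𝓡∂ 2) η) {i : S} {C : Set S} (hC : IsCompact C)
    (hCi : C ⊆ (extChartAt (𝓡∂ 2) i).source) (hηC : ∀ z ∉ C, η z = 0) :
    chartIntegral j i (extD (𝓡∂ 2) η) =
      ∫ t in {t : ℝ | !₂[(0 : ℝ), t] ∈ (extChartAt (𝓡∂ 2) i).target},
        chartSign j i !₂[(0 : ℝ), t] *
          formInChart (𝓡∂ 2) η i !₂[(0 : ℝ), t] ![-EuclideanSpace.single 1 1] := by
  set T := (extChartAt (𝓡∂ 2) i).target with hTdef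
  set ζ := formInChart (𝓡∂ 2) η i with hζdef
  set C' := extChartAt (𝓡∂ 2) i '' C with hC'def
  have hC' : IsCompact C' := isCompact_image_extChartAt hC hCi
  have hC'T : C' ⊆ T := by
    rintro _ ⟨z, hz, rfl⟩
    exact (extChartAt (𝓡∂ 2) i).map_source (hCi hz)
  have hTR : T ⊆ Set.range (𝓡∂ 2) := extChartAt_target_subset_range i
  have hTn : ∀ y ∈ T, T ∈ 𝓝[Set.range (𝓡∂ 2)] y := fun y hy =>
    extChartAt_target_mem_nhdsWithin_of_mem hy
  have hζ0 : ∀ y ∈ T, y ∉ C' → ζ y = 0 := fun y hy hyC =>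
    formInChart_eq_zero (hηC _ (symm_notMem_of_notMem_image hy hyC))
  have hD0 : ∀ y ∈ T, y ∉ C' → fderivWithin ℝ ζ (Set.range (𝓡∂ 2)) y = 0 := by
    intro y hy hyC
    have h1 : ζ =ᶠ[𝓝[Set.range (𝓡∂ 2)] y] fun _ => 0 := by
      filter_upwards [hTn y hy, nhdsWithin_le_nhds (hC'.isClosed.isOpen_compl.mem_nhds hyC)]
        with y' h1 h2
      exact hζ0 y' h1 h2
    rw [h1.fderivWithin_eq (hζ0 y hy hyC), fderivWithin_fun_const]
    rfl
  have hDc : ContinuousOn (fderivWithin ℝ ζ (Set.range (𝓡∂ 2))) T := fun y hy =>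
    (((hη.contDiffWithinAt hy).fderivWithin_right (m := 0) (𝓡∂ 2).uniqueDiffOn (by simp)
      (hTR hy)).continuousWithinAt).mono hTR
  have hsc : ContinuousOn (chartSign j i) T := continuousOn_chartSign hj i
  have key := integral_halfPlane (G := T.indicator fun y => chartSign j i y • ζ y)
    (D := T.indicator fun y => chartSign j i y • fderivWithin ℝ ζ (Set.range (𝓡∂ 2)) y) hC' ?_ ?_
    (continuousOn_indicator_of_closed hC'.isClosed hC'T hTn (hsc.smul (hη i).continuousOn) ?_)
    (continuousOn_indicator_of_closed hC'.isClosed hC'T hTn (hsc.smul hDc) ?_) ?_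
  · have hL : chartIntegral j i (extD (𝓡∂ 2) η) = ∫ y in Set.range (𝓡∂ 2),
        ((T.indicator fun y => chartSign j i y • fderivWithin ℝ ζ (Set.range (𝓡∂ 2)) y) y
          (EuclideanSpace.single 0 1) ![EuclideanSpace.single 1 1] -
        (T.indicator fun y => chartSign j i y • fderivWithin ℝ ζ (Set.range (𝓡∂ 2)) y) y
          (EuclideanSpace.single 1 1) ![EuclideanSpace.single 0 1]) := by
      rw [chartIntegral, ← hTdef]
      rw [MeasureTheory.setIntegral_eq_of_subset_of_forall_sdiff_eq_zero
        (𝓡∂ 2).isClosed_range.measurableSet hTR]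
      · refine MeasureTheory.setIntegral_congr_fun (measurableSet_extChartAt_target i) fun y hy => ?_
        simp only [Set.indicator_of_mem (show y ∈ T from hy)]
        rw [formInChart_extD hη hy, extDerivWithin_oneForm_apply]
        exact mul_sub _ _ _
      · rintro y ⟨-, hy⟩
        simp only [Set.indicator_of_notMem hy]
        simp
    rw [hL, key, ← MeasureTheory.integral_indicator, ← MeasureTheory.integral_neg]
    · congr 1
      funext t
      by_cases ht : !₂[(0 : ℝ), t] ∈ T
      · rw [Set.indicator_of_mem ht, Set.indicator_of_mem (show t ∈ {t : ℝ | !₂[(0 : ℝ), t] ∈ T} from ht)]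
        have h1 : ζ !₂[(0 : ℝ), t] ![-EuclideanSpace.single 1 1] =
            -ζ !₂[(0 : ℝ), t] ![EuclideanSpace.single 1 1] := by
          rw [← neg_one_smul ℝ]
          exact ((ζ _).map_vecCons_smul ![] (-1) _).trans (by simp)
        rw [h1, mul_neg]
        rfl
      · rw [Set.indicator_of_notMem ht,
          Set.indicator_of_notMem (show t ∉ {t : ℝ | !₂[(0 : ℝ), t] ∈ T} from ht)]
        simp
    · exact continuous_boundaryLine.measurable (measurableSet_extChartAt_target i)
  · intro y hy
    by_cases hyT : y ∈ T
    · rw [Set.indicator_of_mem hyT, hζ0 y hyT hy, smul_zero]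
    · exact Set.indicator_of_notMem hyT _
  · intro y hy
    by_cases hyT : y ∈ T
    · rw [Set.indicator_of_mem hyT, hD0 y hyT hy]
      ext v w
      exact mul_zero _
    · exact Set.indicator_of_notMem hyT _
  · intro y hyT hy
    rw [hζ0 y hyT hy, smul_zero]
  · intro y hyT hy
    rw [hD0 y hyT hy]
    ext v w
    exact mul_zero _
  · intro y hy
    by_cases hyT : y ∈ T
    · have hRn : Set.range (𝓡∂ 2) ∈ 𝓝 y := by
        rw [← mem_interior_iff_mem_nhds, interior_range_modelWithCornersEuclideanHalfSpace]
        exact hy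
      have hTy : T ∈ 𝓝 y := by
        have := hTn y hyT
        rwa [nhdsWithin_eq_nhds.2 hRn] at this
      have h1 : HasFDerivAt ζ (fderivWithin ℝ ζ (Set.range (𝓡∂ 2)) y) y :=
        (hη.differentiableWithinAt hyT).hasFDerivWithinAt.hasFDerivAt hRn
      rw [Set.indicator_of_mem hyT]
      refine (h1.const_smul (chartSign j i y)).congr_of_eventuallyEq ?_
      have h2 := chartSign_eventuallyEq hj (i := i) hyT
      rw [nhdsWithin_eq_nhds.2 hTy] at h2
      filter_upwards [h2, hTy] with y' h3 h4
      rw [Set.indicator_of_mem h4, h3]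
      rfl
    · rw [Set.indicator_of_notMem hyT]
      refine (hasFDerivAt_const (0 : EuclideanSpace ℝ (Fin 2) [⋀^Fin 1]→L[ℝ] ℝ)
        y).congr_of_eventuallyEq ?_
      filter_upwards [hC'.isClosed.isOpen_compl.mem_nhds fun h => hyT (hC'T h)] with y' hy'
      by_cases hyT' : y' ∈ T
      · rw [Set.indicator_of_mem hyT', hζ0 y' hyT' hy', smul_zero]
      · exact Set.indicator_of_notMem hyT' _

theorem symm_mem_boundary [IsManifold (𝓡∂ 2) ∞ S] {i : S} {y : EuclideanSpace ℝ (Fin 2)}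
    (hy : y ∈ (extChartAt (𝓡∂ 2) i).target) (hy0 : y 0 = 0) :
    (extChartAt (𝓡∂ 2) i).symm y ∈ (𝓡∂ 2).boundary S := by
  have hx : (extChartAt (𝓡∂ 2) i).symm y ∈ (chartAt (EuclideanHalfSpace 2) i).source := by
    rw [← extChartAt_source (𝓡∂ 2)]
    exact (extChartAt (𝓡∂ 2) i).map_target hy
  have h := (𝓡∂ 2).isInteriorPoint_iff_of_mem_atlas (n := ∞) (by simp)
    (chart_mem_atlas (EuclideanHalfSpace 2) i) hx
  refine ((𝓡∂ 2).isBoundaryPoint_iff_not_isInteriorPoint _).2 fun hinterior => ?_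
  have h1 : y ∈ interior (extChartAt (𝓡∂ 2) i).target := by
    have h2 := h.1 hinterior
    change extChartAt (𝓡∂ 2) i ((extChartAt (𝓡∂ 2) i).symm y) ∈
      interior (extChartAt (𝓡∂ 2) i).target at h2
    rwa [(extChartAt (𝓡∂ 2) i).right_inv hy] at h2
  have h3 := interior_mono (extChartAt_target_subset_range i) h1
  rw [interior_range_modelWithCornersEuclideanHalfSpace] at h3
  exact absurd hy0 (ne_of_gt h3)

variable [IsManifold (𝓡∂ 2) ∞ S] [T2Space S] [CompactSpace S]

theorem boundaryIntegral_eq_sum (η : DForm (𝓡∂ 2) S 1) :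
    boundaryIntegral j η = ∑ i ∈ partitionIndices S,
      ∫ t in {t : ℝ | !₂[(0 : ℝ), t] ∈ (extChartAt (𝓡∂ 2) i).target},
        chartSign j i !₂[(0 : ℝ), t] * formInChart (𝓡∂ 2) (localPart i η) i !₂[(0 : ℝ), t]
          ![-EuclideanSpace.single 1 1] := by
  refine (finsum_eq_sum_of_support_subset _ (s := partitionIndices S) fun i hi => ?_).trans ?_
  · by_contra h
    exact hi (by simp [chartPartition_eq_zero h])
  · refine Finset.sum_congr rfl fun i _ => ?_
    congr 1
    funext t
    exact mul_left_comm (chartPartition S i ((extChartAt (𝓡∂ 2) i).symm !₂[(0 : ℝ), t]))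
      (chartSign j i !₂[(0 : ℝ), t]) (formInChart (𝓡∂ 2) η i !₂[(0 : ℝ), t] _)

/-- Stokes' theorem on a compact surface with boundary. -/
theorem surfaceIntegral_extD (hj : IsComplexStructure (𝓡∂ 2) j) {η : DForm (𝓡∂ 2) S 1}
    (hη : SmoothForm (𝓡∂ 2) η) : surfaceIntegral j (extD (𝓡∂ 2) η) = boundaryIntegral j η := by
  have h1 : extD (𝓡∂ 2) η = ∑ i ∈ partitionIndices S, extD (𝓡∂ 2) (localPart i η) := by
    rw [← extD_sum _ fun i _ => hη.localPart i, sum_localPart]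
  rw [h1, surfaceIntegral_sum hj _ fun i _ => (hη.localPart i).extD, boundaryIntegral_eq_sum]
  refine Finset.sum_congr rfl fun i _ => ?_
  have hC : IsCompact (tsupport (chartPartition S i)) := (isClosed_tsupport _).isCompact
  rw [surfaceIntegral_eq_chartIntegral hj (hη.localPart i).extD hC
    (tsupport_chartPartition_subset i), chartIntegral_extD hj (hη.localPart i) hC
    (tsupport_chartPartition_subset i) fun _ => localPart_eq_zero]
  intro z hz
  refine extD_eq_zero_of_eventuallyEq ?_
  filter_upwards [(isClosed_tsupport _).isOpen_compl.mem_nhds hz] with z' hz'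
  exact localPart_eq_zero hz'

theorem integrableOn_boundary_localPart (hj : IsComplexStructure (𝓡∂ 2) j)
    {η : DForm (𝓡∂ 2) S 1} {i : S} (hη : ContinuousOn (formInChart (𝓡∂ 2) η i)
      {y ∈ (extChartAt (𝓡∂ 2) i).target | y 0 = 0}) :
    MeasureTheory.IntegrableOn (fun t : ℝ => chartSign j i !₂[(0 : ℝ), t] *
        formInChart (𝓡∂ 2) (localPart i η) i !₂[(0 : ℝ), t] ![-EuclideanSpace.single 1 1])
      {t : ℝ | !₂[(0 : ℝ), t] ∈ (extChartAt (𝓡∂ 2) i).target} := by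
  set T := (extChartAt (𝓡∂ 2) i).target with hT
  set C := extChartAt (𝓡∂ 2) i '' tsupport (chartPartition S i)
  have hC : IsCompact C := isCompact_image_extChartAt (isClosed_tsupport _).isCompact
    (tsupport_chartPartition_subset i)
  have hCT : C ⊆ T := by
    rintro _ ⟨z, hz, rfl⟩
    exact (extChartAt (𝓡∂ 2) i).map_source (tsupport_chartPartition_subset i hz)
  have hC' : IsCompact ((fun t : ℝ => !₂[(0 : ℝ), t]) ⁻¹' C) := by
    refine (hC.image (EuclideanSpace.proj (𝕜 := ℝ) (1 : Fin 2)).continuous).of_isClosed_subset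
      (hC.isClosed.preimage continuous_boundaryLine) fun t ht => ⟨_, ht, ?_⟩
    simp
  have hcont : ContinuousOn (fun t : ℝ => chartSign j i !₂[(0 : ℝ), t] *
      formInChart (𝓡∂ 2) (localPart i η) i !₂[(0 : ℝ), t] ![-EuclideanSpace.single 1 1])
      {t : ℝ | !₂[(0 : ℝ), t] ∈ T} := by
    have hmaps : Set.MapsTo (fun t : ℝ => !₂[(0 : ℝ), t]) {t : ℝ | !₂[(0 : ℝ), t] ∈ T}
        {y ∈ T | y 0 = 0} := fun t ht => ⟨ht, by simp⟩
    have h1 : ContinuousOn (formInChart (𝓡∂ 2) (localPart i η) i) {y ∈ T | y 0 = 0} :=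
      ((contDiffOn_comp_extChartAt_symm (chartPartition S i).contMDiff i).continuousOn.mono
        (fun y hy => hy.1)).smul hη
    refine ContinuousOn.mul ?_ ?_
    · exact (continuousOn_chartSign hj i).comp continuous_boundaryLine.continuousOn fun t ht => ht
    · exact (ContinuousAlternatingMap.apply ℝ (EuclideanSpace ℝ (Fin 2)) ℝ
        _).continuous.comp_continuousOn (h1.comp continuous_boundaryLine.continuousOn hmaps)
  refine MeasureTheory.IntegrableOn.of_forall_sdiff_eq_zero
    ((hcont.mono fun t ht => hCT ht).integrableOn_compact hC')
    (continuous_boundaryLine.measurable (measurableSet_extChartAt_target i)) ?_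
  rintro t ⟨ht, htC⟩
  rw [formInChart_eq_zero (localPart_eq_zero (symm_notMem_of_notMem_image ht htC))]
  simp

/-- Positively oriented tangent vectors `τ` of the boundary are those for which `j τ` points
inwards; this is what is needed of them to compare integrals over the boundary. -/
theorem boundaryIntegral_mono (hj : IsComplexStructure (𝓡∂ 2) j) {η η' : DForm (𝓡∂ 2) S 1}
    (hη : ∀ i, ContinuousOn (formInChart (𝓡∂ 2) η i)
      {y ∈ (extChartAt (𝓡∂ 2) i).target | y 0 = 0})
    (hη' : ∀ i, ContinuousOn (formInChart (𝓡∂ 2) η' i)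
      {y ∈ (extChartAt (𝓡∂ 2) i).target | y 0 = 0})
    (h : ∀ z ∈ (𝓡∂ 2).boundary S, ∀ i : S, z ∈ (extChartAt (𝓡∂ 2) i).source →
      ∀ τ : TangentSpace (𝓡∂ 2) z, 0 < chartDeriv (𝓡∂ 2) i z (j z τ) 0 → η z ![τ] ≤ η' z ![τ]) :
    boundaryIntegral j η ≤ boundaryIntegral j η' := by
  rw [boundaryIntegral_eq_sum, boundaryIntegral_eq_sum]
  refine Finset.sum_le_sum fun i _ => MeasureTheory.setIntegral_mono_on
    (integrableOn_boundary_localPart hj (hη i)) (integrableOn_boundary_localPart hj (hη' i))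
    (continuous_boundaryLine.measurable (measurableSet_extChartAt_target i)) fun t ht => ?_
  have hy : !₂[(0 : ℝ), t] ∈ (extChartAt (𝓡∂ 2) i).target := ht
  set y := !₂[(0 : ℝ), t] with hydef
  set s := chartSign j i y with hs
  have hA := complexStructure_plane_identities (endoInChart_sq hj hy)
  have hspos := chartSign_mul_pos hj hy
  set τ : TangentSpace (𝓡∂ 2) ((extChartAt (𝓡∂ 2) i).symm y) :=
    chartSymmDeriv (𝓡∂ 2) i y (s • -EuclideanSpace.single 1 1) with hτ
  have hpos : 0 < chartDeriv (𝓡∂ 2) i _ (j _ τ) 0 := by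
    rw [hτ, ← chartSymmDeriv_endoInChart hy, chartDeriv_chartSymmDeriv hy, map_smul, map_neg]
    change 0 < s * -endoInChart (𝓡∂ 2) j i y (EuclideanSpace.single 1 1) 0
    obtain ⟨h1, hc, -⟩ := hA
    rcases chartSign_eq_or hj hy with h2 | h2 <;> rw [← hs] at h2 <;> rw [← hs, h2] at hspos <;>
      rw [h2]
    · nlinarith [sq_nonneg (endoInChart (𝓡∂ 2) j i y (EuclideanSpace.single 0 1) 0)]
    · nlinarith [sq_nonneg (endoInChart (𝓡∂ 2) j i y (EuclideanSpace.single 0 1) 0)]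
  have hle := h _ (symm_mem_boundary hy (by simp [hydef])) i
    ((extChartAt (𝓡∂ 2) i).map_target hy) τ hpos
  rw [hτ, ← formInChart_apply_one, ← formInChart_apply_one] at hle
  have hsm : ∀ ζ : DForm (𝓡∂ 2) S 1, formInChart (𝓡∂ 2) ζ i y ![s • -EuclideanSpace.single 1 1] =
      s * formInChart (𝓡∂ 2) ζ i y ![-EuclideanSpace.single 1 1] := fun ζ =>
    (formInChart (𝓡∂ 2) ζ i y).map_vecCons_smul ![] s _
  rw [hsm, hsm] at hle
  have hlp : ∀ ζ : DForm (𝓡∂ 2) S 1, s * formInChart (𝓡∂ 2) (localPart i ζ) i y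
      ![-EuclideanSpace.single 1 1] = chartPartition S i ((extChartAt (𝓡∂ 2) i).symm y) *
        (s * formInChart (𝓡∂ 2) ζ i y ![-EuclideanSpace.single 1 1]) := fun ζ =>
    mul_left_comm s (chartPartition S i ((extChartAt (𝓡∂ 2) i).symm y))
      (formInChart (𝓡∂ 2) ζ i y ![-EuclideanSpace.single 1 1])
  rw [hlp, hlp]
  exact mul_le_mul_of_nonneg_left hle ((chartPartition S).nonneg i _)

end Stokes

section Hamiltonian

variable {E : Type*} [NormedAddCommGroup E] [NormedSpace ℝ E]
  {H : Type*} [TopologicalSpace H] {I : ModelWithCorners ℝ E H}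
  {M : Type*} [TopologicalSpace M] [ChartedSpace H M]

theorem exists_symplecticDual [FiniteDimensional ℝ E] {x : M}
    {φ : TangentSpace I x [⋀^Fin 2]→L[ℝ] ℝ}
    (hφ : ∀ v : TangentSpace I x, (∀ w : TangentSpace I x, φ ![v, w] = 0) → v = 0)
    (η : TangentSpace I x →L[ℝ] ℝ) :
    ∃ X : TangentSpace I x, ∀ w : TangentSpace I x, φ ![X, w] = η w := by
  have : FiniteDimensional ℝ (TangentSpace I x) := inferInstanceAs (FiniteDimensional ℝ E)
  let L : TangentSpace I x →ₗ[ℝ] Module.Dual ℝ (TangentSpace I x) :=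
    LinearMap.mk₂ ℝ (fun v w => φ ![v, w]) (twoForm_add_left φ) (twoForm_smul_left φ)
      (twoForm_add_right φ) (fun r v w => twoForm_smul_right φ r v w)
  have hinj : Function.Injective L := by
    rw [← LinearMap.ker_eq_bot, LinearMap.ker_eq_bot']
    exact fun v hv => hφ v fun w => DFunLike.congr_fun hv w
  have hsurj : Function.Surjective L :=
    (LinearMap.injective_iff_surjective_of_finrank_eq_finrank
      Subspace.dual_finrank_eq.symm).1 hinj
  obtain ⟨X, hX⟩ := hsurj (η : TangentSpace I x →ₗ[ℝ] ℝ)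
  exact ⟨X, fun w => DFunLike.congr_fun hX w⟩

theorem hamVF_spec [FiniteDimensional ℝ E] {Ω : DForm I M 2} (hΩ : IsSymplectic I Ω) (f : M → ℝ)
    (x : M) (v : TangentSpace I x) : Ω x ![hamVF I Ω f x, v] = differential I f x v := by
  have h := exists_symplecticDual (hΩ.nondegenerate x) (differential I f x)
  have h' : ∃ X : TangentSpace I x, ∀ w : TangentSpace I x,
      Ω x ![X, w] = (fun v => (mfderiv I 𝓘(ℝ, ℝ) f x v : ℝ)) w := h
  have h'' : hamVF I Ω f x = h'.choose := dif_pos h'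
  rw [h'']
  exact h'.choose_spec v

theorem differential_hamVF_self [FiniteDimensional ℝ E] {Ω : DForm I M 2}
    (hΩ : IsSymplectic I Ω) (f : M → ℝ) (x : M) : differential I f x (hamVF I Ω f x) = 0 := by
  rw [← hamVF_spec hΩ, twoForm_self]

theorem hamVF_eq_smul [FiniteDimensional ℝ E] {Ω : DForm I M 2}
    (hΩ : IsSymplectic I Ω) {f g : M → ℝ} {x : M} {r : ℝ}
    (h : differential I f x = r • differential I g x) :
    hamVF I Ω f x = r • hamVF I Ω g x := by
  refine sub_eq_zero.1 (hΩ.nondegenerate x _ fun w => ?_)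
  rw [twoForm_sub_left, twoForm_smul_left, hamVF_spec hΩ, hamVF_spec hΩ, h]
  exact sub_self _

end Hamiltonian

section FunctionForms

variable {E : Type*} [NormedAddCommGroup E] [NormedSpace ℝ E]
  {H : Type*} [TopologicalSpace H] {I : ModelWithCorners ℝ E H}
  {M : Type*} [TopologicalSpace M] [ChartedSpace H M]
  {E' : Type*} [NormedAddCommGroup E'] [NormedSpace ℝ E']
  {H' : Type*} [TopologicalSpace H'] {I' : ModelWithCorners ℝ E' H'}
  {M' : Type*} [TopologicalSpace M'] [ChartedSpace H' M']

theorem formInChart_graph (K : FunForm I M M') {u : M → M'} {z₀ : M} {w₀ : M'} {y : E}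
    (hw : u ((extChartAt I z₀).symm y) ∈ (extChartAt I' w₀).source) :
    formInChart I (fun z => K z (u z)) z₀ y = formInChart I (fun z => K z ((extChartAt I' w₀).symm
      ((extChartAt I' w₀ ∘ u ∘ (extChartAt I z₀).symm) y))) z₀ y := by
  simp only [formInChart, Function.comp_apply, (extChartAt I' w₀).left_inv hw]

theorem formInChart_graph_eventuallyEq (K : FunForm I M M') {u : M → M'}
    (hu : ContMDiff I I' ∞ u) {z₀ : M} {w₀ : M'} {y : E} (hy : y ∈ (extChartAt I z₀).target)
    (hw : u ((extChartAt I z₀).symm y) ∈ (extChartAt I' w₀).source) :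
    ∀ᶠ y' in 𝓝[Set.range I] y,
      (y', (extChartAt I' w₀ ∘ u ∘ (extChartAt I z₀).symm) y') ∈
        (extChartAt I z₀).target ×ˢ (extChartAt I' w₀).target ∧
      formInChart I (fun z => K z (u z)) z₀ y' = formInChart I (fun z => K z ((extChartAt I' w₀).symm
        ((extChartAt I' w₀ ∘ u ∘ (extChartAt I z₀).symm) y'))) z₀ y' := by
  filter_upwards [chart_preimage_mem_nhdsWithin hy hu.continuous.continuousAt
    (extChartAt_source_mem_nhds' hw)] with y' h1
  exact ⟨⟨h1.1, (extChartAt I' w₀).map_source h1.2⟩, formInChart_graph K h1.2⟩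

/-- The restriction of a function-valued form to the graph of a smooth map is smooth. -/
theorem SmoothFunForm.smoothForm_graph [IsManifold I ∞ M] [IsManifold I' ∞ M']
    {K : FunForm I M M'} (hK : SmoothFunForm I I' K)
    {u : M → M'} (hu : ContMDiff I I' ∞ u) : SmoothForm I (fun z => K z (u z)) := by
  intro z₀ y hy
  set w₀ := u ((extChartAt I z₀).symm y) with hw₀
  have hw : u ((extChartAt I z₀).symm y) ∈ (extChartAt I' w₀).source := mem_extChartAt_source _
  have hev := formInChart_graph_eventuallyEq K hu hy hw
  have hyr : y ∈ Set.range I := extChartAt_target_subset_range z₀ hy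
  have h1 := contDiffWithinAt_inCharts hy hu.contMDiffAt hw
  have h2 := (hK z₀ w₀ (y, (extChartAt I' w₀ ∘ u ∘ (extChartAt I z₀).symm) y)
    (hev.self_of_nhdsWithin hyr).1).comp_of_preimage_mem_nhdsWithin y (contDiffWithinAt_id.prodMk h1)
      (hev.mono fun _ h => h.1)
  exact (h2.congr_of_eventuallyEq (hev.mono fun _ h => h.2) (hev.self_of_nhdsWithin hyr).2).mono
    (extChartAt_target_subset_range z₀)

theorem range_prod_target_mem (z : M) (w : M') :
    (extChartAt I z).target ×ˢ (extChartAt I' w).target ∈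
      𝓝[Set.range I ×ˢ Set.range I'] (extChartAt I z z, extChartAt I' w w) := by
  rw [nhdsWithin_prod_eq]
  exact Filter.prod_mem_prod (extChartAt_target_mem_nhdsWithin z)
    (extChartAt_target_mem_nhdsWithin w)

/-- The exterior derivative of the restriction of a function-valued form to a graph. -/
theorem extD_graph_apply [IsManifold I ∞ M] [IsManifold I' ∞ M']
    {K : FunForm I M M'} (hK : SmoothFunForm I I' K) {u : M → M'}
    (hu : ContMDiff I I' ∞ u) (z : M) (ξ ξ' : TangentSpace I z) :
    extD I (fun z => K z (u z)) z ![ξ, ξ'] = extD I (fun z' => K z' (u z)) z ![ξ, ξ'] +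
      differential I' (fun w => K z w ![ξ']) (u z) (mfderiv I I' u z ξ) -
      differential I' (fun w => K z w ![ξ]) (u z) (mfderiv I I' u z ξ') := by
  set w := u z with hw
  set y₀ := extChartAt I z z with hy₀
  set q₀ := extChartAt I' w w with hq₀
  let F : E × E' → E [⋀^Fin 1]→L[ℝ] ℝ := fun p =>
    formInChart I (fun z => K z ((extChartAt I' w).symm p.2)) z p.1
  have hyT : y₀ ∈ (extChartAt I z).target := mem_extChartAt_target z
  have hyr : y₀ ∈ Set.range I := extChartAt_target_subset_range z hyT
  have hqr : q₀ ∈ Set.range I' := extChartAt_target_subset_range w (mem_extChartAt_target w)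
  have hF : HasFDerivWithinAt F (fderivWithin ℝ F (Set.range I ×ˢ Set.range I') (y₀, q₀))
      (Set.range I ×ˢ Set.range I') (y₀, q₀) :=
    (((hK z w (y₀, q₀) ⟨hyT, mem_extChartAt_target w⟩).mono_of_mem_nhdsWithin
      (range_prod_target_mem z w)).differentiableWithinAt (by simp)).hasFDerivWithinAt
  set F' := fderivWithin ℝ F (Set.range I ×ˢ Set.range I') (y₀, q₀) with hF'
  have hsy : (extChartAt I z).symm y₀ = z := extChartAt_to_inv z
  have huy : u ((extChartAt I z).symm y₀) ∈ (extChartAt I' w).source := by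
    rw [hsy]
    exact mem_extChartAt_source w
  let U : E → E' := extChartAt I' w ∘ u ∘ (extChartAt I z).symm
  have hU0 : U y₀ = q₀ := by
    simp only [U, Function.comp_apply, hsy]
    rfl
  have hU : HasFDerivWithinAt U (mfderiv I I' u z : E →L[ℝ] E') (Set.range I) y₀ :=
    (hu.mdifferentiableAt (by simp)).hasMFDerivAt.2
  have hgraph : HasFDerivWithinAt (fun y => F (y, U y))
      (F' ∘L (ContinuousLinearMap.id ℝ E).prod (mfderiv I I' u z : E →L[ℝ] E'))
      (Set.range I) y₀ := by
    have h1 : HasFDerivWithinAt (fun y => (y, U y))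
      ((ContinuousLinearMap.id ℝ E).prod (mfderiv I I' u z : E →L[ℝ] E')) (Set.range I) y₀ :=
      (hasFDerivWithinAt_id y₀ _).prodMk hU
    have h2 : HasFDerivWithinAt F F' (Set.range I ×ˢ Set.range I') (y₀, U y₀) := by
      rw [hU0]
      exact hF
    exact HasFDerivWithinAt.comp (t := Set.range I ×ˢ Set.range I') y₀ h2 h1
      fun y hy => ⟨hy, Set.mem_range_self _⟩
  have hκ : HasFDerivWithinAt (formInChart I (fun z => K z (u z)) z)
      (F' ∘L (ContinuousLinearMap.id ℝ E).prod (mfderiv I I' u z : E →L[ℝ] E'))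
      (Set.range I) y₀ := by
    have hev := formInChart_graph_eventuallyEq K hu hyT huy
    exact hgraph.congr_of_eventuallyEq (hev.mono fun _ h => h.2) (hev.self_of_nhdsWithin hyr).2
  have hfix : HasFDerivWithinAt (formInChart I (fun z' => K z' w) z)
      (F' ∘L ContinuousLinearMap.inl ℝ E E') (Set.range I) y₀ := by
    have h1 : HasFDerivWithinAt (fun y : E => (y, q₀)) (ContinuousLinearMap.inl ℝ E E')
      (Set.range I) y₀ := (hasFDerivAt_prodMk_left y₀ q₀).hasFDerivWithinAt
    have h2 := HasFDerivWithinAt.comp (t := Set.range I ×ˢ Set.range I') y₀ hF h1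
      fun y hy => ⟨hy, hqr⟩
    have h3 : formInChart I (fun z' => K z' w) z = F ∘ fun y : E => (y, q₀) := by
      funext y
      simp only [F, Function.comp_apply, hq₀, extChartAt_to_inv]
    rw [h3]
    exact h2
  have hpar : ∀ (ζ : TangentSpace I z) (v : TangentSpace I' w),
      differential I' (fun w' => K z w' ![ζ]) w v = F' (0, v) ![ζ] := by
    intro ζ v
    have h1 : HasFDerivWithinAt (fun q : E' => (y₀, q)) (ContinuousLinearMap.inr ℝ E E')
      (Set.range I') q₀ := (hasFDerivAt_prodMk_right y₀ q₀).hasFDerivWithinAt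
    have h2 := HasFDerivWithinAt.comp (t := Set.range I ×ˢ Set.range I') q₀ hF h1
      fun q hq => ⟨hyr, hq⟩
    have h3 := (ContinuousAlternatingMap.apply ℝ E ℝ ![(ζ : E)]).hasFDerivAt.comp_hasFDerivWithinAt
      q₀ h2
    have h4 : ∀ q : E', K z ((extChartAt I' w).symm q) ![ζ] = F (y₀, q) ![(ζ : E)] := fun q =>
      (formInChart_self_apply_one (fun z => K z ((extChartAt I' w).symm q)) z ζ).symm
    have h5 : ContinuousAt (fun w' => K z w' ![ζ]) w := by
      have h6 : ContinuousAt (fun w' => F (y₀, extChartAt I' w w') ![(ζ : E)]) w := by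
        have h7 := h3.continuousWithinAt.comp (f := extChartAt I' w) (x := w) (s := Set.univ)
          (continuousAt_extChartAt (I := I') w).continuousWithinAt
          (fun w' _ => Set.mem_range_self _)
        exact (continuousWithinAt_univ _ _).1 h7
      refine h6.congr ?_
      filter_upwards [extChartAt_source_mem_nhds (I := I') w] with w' hw'
      rw [← h4, (extChartAt I' w).left_inv hw']
    have h8 : HasMFDerivAt I' 𝓘(ℝ, ℝ) (fun w' => K z w' ![ζ]) w
        ((ContinuousAlternatingMap.apply ℝ E ℝ ![(ζ : E)]) ∘L F' ∘L
          ContinuousLinearMap.inr ℝ E E' : E' →L[ℝ] ℝ) := by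
      refine ⟨h5, h3.congr (fun q _ => h4 q) (h4 q₀)⟩
    rw [differential, h8.mfderiv]
    rfl
  rw [extD_apply_one, extD_apply_one, hpar, hpar]
  erw [extDerivWithin_oneForm_apply, extDerivWithin_oneForm_apply]
  rw [hκ.fderivWithin (I.uniqueDiffOn y₀ hyr), hfix.fderivWithin (I.uniqueDiffOn y₀ hyr)]
  have hsplit : ∀ (a : E) (b : E'), F' (a, b) = F' (a, 0) + F' (0, b) := by
    intro a b
    rw [← map_add]
    simp
  change F' (ξ, mfderiv I I' u z ξ) ![ξ'] - F' (ξ', mfderiv I I' u z ξ') ![ξ] =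
    F' (ξ, 0) ![ξ'] - F' (ξ', 0) ![ξ] + F' (0, mfderiv I I' u z ξ) ![ξ'] -
      F' (0, mfderiv I I' u z ξ') ![ξ]
  erw [hsplit ξ, hsplit ξ']
  erw [ContinuousAlternatingMap.add_apply, ContinuousAlternatingMap.add_apply]
  ring

end FunctionForms

section LocalExtrema

/-- At a local minimum, the derivative in inward directions is non-negative. -/
theorem differential_nonneg_of_inward {n : ℕ} [NeZero n] {S : Type*} [TopologicalSpace S]
    [ChartedSpace (EuclideanHalfSpace n) S] [IsManifold (𝓡∂ n) ∞ S] {f : S → ℝ} {z i : S}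
    (hz : z ∈ (extChartAt (𝓡∂ n) i).source) (hf : MDifferentiableAt (𝓡∂ n) 𝓘(ℝ, ℝ) f z)
    (hmin : ∀ᶠ z' in 𝓝 z, f z ≤ f z') {v : TangentSpace (𝓡∂ n) z}
    (hv : 0 < chartDeriv (𝓡∂ n) i z v 0) : 0 ≤ differential (𝓡∂ n) f z v := by
  obtain ⟨y, hy, rfl⟩ : ∃ y ∈ (extChartAt (𝓡∂ n) i).target, (extChartAt (𝓡∂ n) i).symm y = z :=
    ⟨_, (extChartAt (𝓡∂ n) i).map_source hz, (extChartAt (𝓡∂ n) i).left_inv hz⟩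
  have : IsManifold (𝓡∂ n) 1 S := .of_le (n := ∞) (by simp)
  have h1 : HasMFDerivWithinAt 𝓘(ℝ, _) (𝓡∂ n) (extChartAt (𝓡∂ n) i).symm (Set.range (𝓡∂ n)) y
      (chartSymmDeriv (𝓡∂ n) i y) :=
    (mdifferentiableWithinAt_extChartAt_symm hy).hasMFDerivWithinAt
  have h2 : HasFDerivWithinAt (f ∘ (extChartAt (𝓡∂ n) i).symm)
      (differential (𝓡∂ n) f ((extChartAt (𝓡∂ n) i).symm y) ∘L chartSymmDeriv (𝓡∂ n) i y)
      (Set.range (𝓡∂ n)) y := (hf.hasMFDerivAt.comp_hasMFDerivWithinAt y h1).hasFDerivWithinAt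
  have h3 : IsLocalMinOn (f ∘ (extChartAt (𝓡∂ n) i).symm) (Set.range (𝓡∂ n)) y :=
    (continuousAt_extChartAt_symm'' hy).continuousWithinAt.eventually hmin
  have h4 : chartDeriv (𝓡∂ n) i _ v ∈ posTangentConeAt (Set.range (𝓡∂ n)) y := by
    have hyr := extChartAt_target_subset_range i hy
    refine mem_posTangentConeAt_of_segment_subset
      ((𝓡∂ n).convex_range.segment_subset hyr ?_)
    rw [range_modelWithCornersEuclideanHalfSpace] at hyr ⊢
    exact add_nonneg hyr hv.le
  have h5 := h3.hasFDerivWithinAt_nonneg h2 h4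
  change 0 ≤ differential (𝓡∂ n) f _ (chartSymmDeriv (𝓡∂ n) i y (chartDeriv (𝓡∂ n) i _ v)) at h5
  rwa [chartSymmDeriv_chartDeriv hy] at h5

/-- A function with vanishing differential near a point is constant near it. -/
theorem eventually_eq_of_differential_eq_zero {E : Type*} [NormedAddCommGroup E] [NormedSpace ℝ E]
    {H : Type*} [TopologicalSpace H] {I : ModelWithCorners ℝ E H}
    {M : Type*} [TopologicalSpace M] [ChartedSpace H M] [IsManifold I ∞ M] {f : M → ℝ} {z : M}
    (hf : ∀ᶠ z' in 𝓝 z, MDifferentiableAt I 𝓘(ℝ, ℝ) f z' ∧ ∀ v, differential I f z' v = 0) :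
    ∀ᶠ z' in 𝓝 z, f z' = f z := by
  have : IsManifold I 1 M := .of_le (n := ∞) (by simp)
  have hzT := mem_extChartAt_target (I := I) z
  have h0 := chart_preimage_mem_nhdsWithin (f := (id : M → M)) hzT continuousAt_id
    (V := {z' | MDifferentiableAt I 𝓘(ℝ, ℝ) f z' ∧ ∀ v, differential I f z' v = 0})
    (by rw [extChartAt_to_inv]; exact hf)
  obtain ⟨r, hr, hrs⟩ := Metric.mem_nhdsWithin_iff.1 h0
  have hconv : Convex ℝ (Metric.ball (extChartAt I z z) r ∩ Set.range I) :=
    (convex_ball _ _).inter I.convex_range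
  have hder : ∀ y ∈ Metric.ball (extChartAt I z z) r ∩ Set.range I,
      HasFDerivWithinAt (f ∘ (extChartAt I z).symm) (0 : E →L[ℝ] ℝ)
        (Metric.ball (extChartAt I z z) r ∩ Set.range I) y := by
    intro y hy
    obtain ⟨hyT, hyd, hy0⟩ := hrs hy
    have h1 : HasMFDerivWithinAt 𝓘(ℝ, _) I (extChartAt I z).symm (Set.range I) y
        (chartSymmDeriv I z y) :=
      (mdifferentiableWithinAt_extChartAt_symm hyT).hasMFDerivWithinAt
    have h2 : HasFDerivWithinAt (f ∘ (extChartAt I z).symm)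
        (differential I f ((extChartAt I z).symm y) ∘L chartSymmDeriv I z y)
        (Set.range I) y := (hyd.hasMFDerivAt.comp_hasMFDerivWithinAt y h1).hasFDerivWithinAt
    have h3 : differential I f ((extChartAt I z).symm y) ∘L chartSymmDeriv I z y = 0 := by
      ext v
      exact hy0 _
    rw [h3] at h2
    exact h2.mono Set.inter_subset_right
  have hzb : extChartAt I z z ∈ Metric.ball (extChartAt I z z) r ∩ Set.range I :=
    ⟨Metric.mem_ball_self hr, extChartAt_target_subset_range z hzT⟩
  have hU : extChartAt I z ⁻¹' Metric.ball (extChartAt I z z) r ∈ 𝓝 z :=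
    (continuousAt_extChartAt z).preimage_mem_nhds (Metric.ball_mem_nhds _ hr)
  filter_upwards [hU, extChartAt_source_mem_nhds (I := I) z] with z' h1 h2
  have h3 : extChartAt I z z' ∈ Metric.ball (extChartAt I z z) r ∩ Set.range I :=
    ⟨h1, Set.mem_range_self _⟩
  have h4 : (f ∘ (extChartAt I z).symm) (extChartAt I z z') =
      (f ∘ (extChartAt I z).symm) (extChartAt I z z) := by
    have h5 := hconv.norm_image_sub_le_of_norm_hasFDerivWithin_le (C := 0) hder
      (fun _ _ => by simp) hzb h3
    rw [zero_mul] at h5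
    exact sub_eq_zero.1 (norm_le_zero_iff.1 h5)
  simp only [Function.comp_apply, (extChartAt I z).left_inv h2, extChartAt_to_inv] at h4
  exact h4

end LocalExtrema

section Collar

variable {m : ℕ}
  {W : Type*} [TopologicalSpace W] [ChartedSpace (EuclideanHalfSpace (2 * m + 2)) W]
  {Y : Type*} [TopologicalSpace Y] [ChartedSpace (EuclideanSpace ℝ (Fin (2 * m + 1))) Y]

theorem pullback_fst_smooth [IsManifold (𝓡 (2 * m + 1)) ∞ Y] {k : ℕ}
    {θ : DForm (𝓡 (2 * m + 1)) Y k} (hθ : SmoothForm (𝓡 (2 * m + 1)) θ) :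
    SmoothForm ((𝓡 (2 * m + 1)).prod 𝓘(ℝ, ℝ))
      (pullback ((𝓡 (2 * m + 1)).prod 𝓘(ℝ, ℝ)) (𝓡 (2 * m + 1)) (Prod.fst : Y × ℝ → Y) θ) :=
  hθ.pullback contMDiff_fst

theorem liouvilleForm_smooth [IsManifold (𝓡 (2 * m + 1)) ∞ Y] {θ : DForm (𝓡 (2 * m + 1)) Y 1}
    (hθ : SmoothForm (𝓡 (2 * m + 1)) θ) :
    SmoothForm ((𝓡 (2 * m + 1)).prod 𝓘(ℝ, ℝ)) (liouvilleForm θ) :=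
  (pullback_fst_smooth hθ).smul (f := (Prod.snd : Y × ℝ → ℝ)) contMDiff_snd

theorem differential_snd (p : Y × ℝ) (a : EuclideanSpace ℝ (Fin (2 * m + 1)) × ℝ) :
    differential ((𝓡 (2 * m + 1)).prod 𝓘(ℝ, ℝ)) (Prod.snd : Y × ℝ → ℝ) p a = a.2 := by
  rw [differential, mfderiv_snd]
  rfl

theorem mfderiv_fst_apply (p : Y × ℝ) (a : EuclideanSpace ℝ (Fin (2 * m + 1)) × ℝ) :
    mfderiv ((𝓡 (2 * m + 1)).prod 𝓘(ℝ, ℝ)) (𝓡 (2 * m + 1)) (Prod.fst : Y × ℝ → Y) p a = a.1 := by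
  rw [mfderiv_fst]
  rfl

theorem extD_liouvilleForm [IsManifold (𝓡 (2 * m + 1)) ∞ Y]
    {θ : DForm (𝓡 (2 * m + 1)) Y 1} (hθ : SmoothForm (𝓡 (2 * m + 1)) θ) (p : Y × ℝ)
    (a b : TangentSpace ((𝓡 (2 * m + 1)).prod 𝓘(ℝ, ℝ)) p) :
    extD ((𝓡 (2 * m + 1)).prod 𝓘(ℝ, ℝ)) (liouvilleForm θ) p ![a, b] =
      differential ((𝓡 (2 * m + 1)).prod 𝓘(ℝ, ℝ)) (Prod.snd : Y × ℝ → ℝ) p a *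
        θ p.1 ![mfderiv ((𝓡 (2 * m + 1)).prod 𝓘(ℝ, ℝ)) (𝓡 (2 * m + 1)) (Prod.fst : Y × ℝ → Y) p b] -
      differential ((𝓡 (2 * m + 1)).prod 𝓘(ℝ, ℝ)) (Prod.snd : Y × ℝ → ℝ) p b *
        θ p.1 ![mfderiv ((𝓡 (2 * m + 1)).prod 𝓘(ℝ, ℝ)) (𝓡 (2 * m + 1)) (Prod.fst : Y × ℝ → Y) p a] +
      p.2 * extD (𝓡 (2 * m + 1)) θ p.1
        ![mfderiv ((𝓡 (2 * m + 1)).prod 𝓘(ℝ, ℝ)) (𝓡 (2 * m + 1)) (Prod.fst : Y × ℝ → Y) p a,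
          mfderiv ((𝓡 (2 * m + 1)).prod 𝓘(ℝ, ℝ)) (𝓡 (2 * m + 1)) (Prod.fst : Y × ℝ → Y) p b] := by
  refine (extD_smul_apply (I := (𝓡 (2 * m + 1)).prod 𝓘(ℝ, ℝ)) (f := (Prod.snd : Y × ℝ → ℝ))
    contMDiff_snd (pullback_fst_smooth hθ) p a b).trans ?_
  rw [extD_pullback hθ contMDiff_fst, pullback_apply_one, pullback_apply_one, pullback_apply_two]

/-- The contraction of `d(ρ θ)` with `∂/∂ρ` is `θ`. -/
theorem extD_liouvilleForm_apply [IsManifold (𝓡 (2 * m + 1)) ∞ Y]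
    {θ : DForm (𝓡 (2 * m + 1)) Y 1} (hθ : SmoothForm (𝓡 (2 * m + 1)) θ) (p : Y × ℝ)
    (b : EuclideanSpace ℝ (Fin (2 * m + 1)) × ℝ) :
    extD ((𝓡 (2 * m + 1)).prod 𝓘(ℝ, ℝ)) (liouvilleForm θ) p
      ![((0, 1) : EuclideanSpace ℝ (Fin (2 * m + 1)) × ℝ), b] = θ p.1 ![b.1] := by
  refine (extD_liouvilleForm hθ p ((0, 1) : EuclideanSpace ℝ (Fin (2 * m + 1)) × ℝ) b).trans ?_
  rw [differential_snd, differential_snd, mfderiv_fst_apply, mfderiv_fst_apply]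
  have h1 : θ p.1 ![(0 : EuclideanSpace ℝ (Fin (2 * m + 1)))] = 0 :=
    (θ p.1).map_coord_zero 0 rfl
  have h2 : extD (𝓡 (2 * m + 1)) θ p.1 ![(0 : EuclideanSpace ℝ (Fin (2 * m + 1))), b.1] = 0 :=
    (extD (𝓡 (2 * m + 1)) θ p.1).map_coord_zero 0 rfl
  erw [h1, h2]
  rw [one_mul, mul_zero, mul_zero, sub_zero, add_zero]

variable {Ω : DForm (𝓡∂ (2 * m + 2)) W 2} {θ : DForm (𝓡 (2 * m + 1)) Y 1} {c : ℝ}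

namespace ConcaveBoundary

variable (B : ConcaveBoundary Ω θ c)

theorem mem_source_of_mem_target {w : W} (hw : w ∈ B.collar.target) :
    c ≤ B.rho w ∧ B.rho w < c + B.ε := by
  have h := B.collar.map_target hw
  rw [B.source_eq] at h
  exact h.2

theorem mem_boundary_iff {w : W} :
    w ∈ (𝓡∂ (2 * m + 2)).boundary W ↔ w ∈ B.collar.target ∧ B.rho w = c := by
  rw [← B.boundary_eq]
  constructor
  · rintro ⟨p, ⟨-, hp⟩, rfl⟩
    have hps : p ∈ B.collar.source := by
      rw [B.source_eq]
      have hp' : p.2 = c := hp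
      exact ⟨Set.mem_univ _, by rw [hp']; exact ⟨le_rfl, by linarith [B.ε_pos]⟩⟩
    refine ⟨B.collar.map_source hps, ?_⟩
    rw [rho, B.collar.left_inv hps]
    exact hp
  · rintro ⟨hw, hr⟩
    exact ⟨B.collar.symm w, ⟨Set.mem_univ _, hr⟩, B.collar.right_inv hw⟩

theorem contMDiffAt_symm {w : W} (hw : w ∈ B.collar.target) :
    ContMDiffAt (𝓡∂ (2 * m + 2)) ((𝓡 (2 * m + 1)).prod 𝓘(ℝ, ℝ)) ∞ B.collar.symm w :=
  B.smooth_symm.contMDiffAt (B.isOpen_target.mem_nhds hw)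

theorem contMDiffAt_rho {w : W} (hw : w ∈ B.collar.target) :
    ContMDiffAt (𝓡∂ (2 * m + 2)) 𝓘(ℝ, ℝ) ∞ B.rho w :=
  contMDiff_snd.contMDiffAt.comp w (B.contMDiffAt_symm hw)

theorem contMDiffAt_proj {w : W} (hw : w ∈ B.collar.target) :
    ContMDiffAt (𝓡∂ (2 * m + 2)) (𝓡 (2 * m + 1)) ∞ B.proj w :=
  contMDiff_fst.contMDiffAt.comp w (B.contMDiffAt_symm hw)

/-- The derivative of the collar. -/
def collarDeriv (p : Y × ℝ) :
    EuclideanSpace ℝ (Fin (2 * m + 1)) × ℝ →L[ℝ] TangentSpace (𝓡∂ (2 * m + 2)) (B.collar p) :=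
  mfderivWithin ((𝓡 (2 * m + 1)).prod 𝓘(ℝ, ℝ)) (𝓡∂ (2 * m + 2)) B.collar B.collar.source p

theorem hasMFDerivWithinAt_collar {p : Y × ℝ} (hp : p ∈ B.collar.source) :
    HasMFDerivWithinAt ((𝓡 (2 * m + 1)).prod 𝓘(ℝ, ℝ)) (𝓡∂ (2 * m + 2)) B.collar B.collar.source p
      (B.collarDeriv p) :=
  ((B.smooth p hp).mdifferentiableWithinAt (by simp)).hasMFDerivWithinAt

theorem uniqueMDiffWithinAt_source {p : Y × ℝ} (hp : p ∈ B.collar.source) :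
    UniqueMDiffWithinAt ((𝓡 (2 * m + 1)).prod 𝓘(ℝ, ℝ)) B.collar.source p := by
  have h : UniqueMDiffOn ((𝓡 (2 * m + 1)).prod 𝓘(ℝ, ℝ))
      ((Set.univ : Set Y) ×ˢ Set.Ico c (c + B.ε)) :=
    uniqueMDiffOn_univ.prod (uniqueDiffOn_Ico c (c + B.ε)).uniqueMDiffOn
  rw [B.source_eq] at hp ⊢
  exact h p hp

theorem differential_rho_collarDeriv {p : Y × ℝ} (hp : p ∈ B.collar.source)
    (a : EuclideanSpace ℝ (Fin (2 * m + 1)) × ℝ) :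
    differential (𝓡∂ (2 * m + 2)) B.rho (B.collar p) (B.collarDeriv p a) = a.2 := by
  have hr := ((B.contMDiffAt_rho (B.collar.map_source hp)).mdifferentiableAt
    (by simp)).hasMFDerivAt
  have h1 := hr.comp_hasMFDerivWithinAt p (B.hasMFDerivWithinAt_collar hp)
  have h2 : HasMFDerivWithinAt ((𝓡 (2 * m + 1)).prod 𝓘(ℝ, ℝ)) 𝓘(ℝ, ℝ) (B.rho ∘ B.collar)
      B.collar.source p (ContinuousLinearMap.snd ℝ (EuclideanSpace ℝ (Fin (2 * m + 1))) ℝ) :=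
    (hasMFDerivWithinAt_snd _ p).congr_mono
      (fun q hq => by simp only [Function.comp_apply, rho, B.collar.left_inv hq])
      (by simp only [Function.comp_apply, rho, B.collar.left_inv hp]) subset_rfl
  exact DFunLike.congr_fun ((B.uniqueMDiffWithinAt_source hp).eq h1 h2) a

theorem mfderiv_proj_collarDeriv {p : Y × ℝ} (hp : p ∈ B.collar.source)
    (a : EuclideanSpace ℝ (Fin (2 * m + 1)) × ℝ) :
    mfderiv (𝓡∂ (2 * m + 2)) (𝓡 (2 * m + 1)) B.proj (B.collar p) (B.collarDeriv p a) = a.1 := by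
  have hr := ((B.contMDiffAt_proj (B.collar.map_source hp)).mdifferentiableAt
    (by simp)).hasMFDerivAt
  have h1 := hr.comp_hasMFDerivWithinAt p (B.hasMFDerivWithinAt_collar hp)
  have h2 : HasMFDerivWithinAt ((𝓡 (2 * m + 1)).prod 𝓘(ℝ, ℝ)) (𝓡 (2 * m + 1)) (B.proj ∘ B.collar)
      B.collar.source p (ContinuousLinearMap.fst ℝ (EuclideanSpace ℝ (Fin (2 * m + 1))) ℝ) :=
    (hasMFDerivWithinAt_fst _ p).congr_mono
      (fun q hq => by simp only [Function.comp_apply, proj, B.collar.left_inv hq])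
      (by simp only [Function.comp_apply, proj, B.collar.left_inv hp]) subset_rfl
  exact DFunLike.congr_fun ((B.uniqueMDiffWithinAt_source hp).eq h1 h2) a

theorem collarDeriv_surjective {p : Y × ℝ} (hp : p ∈ B.collar.source) :
    Function.Surjective (B.collarDeriv p) := by
  have : FiniteDimensional ℝ (TangentSpace (𝓡∂ (2 * m + 2)) (B.collar p)) :=
    inferInstanceAs (FiniteDimensional ℝ (EuclideanSpace ℝ (Fin (2 * m + 2))))
  have hrank : Module.finrank ℝ (EuclideanSpace ℝ (Fin (2 * m + 1)) × ℝ) =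
      Module.finrank ℝ (TangentSpace (𝓡∂ (2 * m + 2)) (B.collar p)) := by
    have h1 : Module.finrank ℝ (TangentSpace (𝓡∂ (2 * m + 2)) (B.collar p)) = 2 * m + 2 :=
      finrank_euclideanSpace_fin (𝕜 := ℝ) (n := 2 * m + 2)
    rw [h1]
    simp
  have hinj : Function.Injective (B.collarDeriv p).toLinearMap := by
    rw [← LinearMap.ker_eq_bot, LinearMap.ker_eq_bot']
    intro a ha
    have ha' : B.collarDeriv p a = 0 := ha
    have h1 := B.differential_rho_collarDeriv hp a
    have h2 := B.mfderiv_proj_collarDeriv hp a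
    rw [ha', map_zero] at h1 h2
    exact Prod.ext h2.symm h1.symm
  exact (LinearMap.injective_iff_surjective_of_finrank_eq_finrank hrank).1 hinj

theorem form_collarDeriv {p : Y × ℝ} (hp : p ∈ B.collar.source)
    (a b : EuclideanSpace ℝ (Fin (2 * m + 1)) × ℝ) :
    Ω (B.collar p) ![B.collarDeriv p a, B.collarDeriv p b] =
      extD ((𝓡 (2 * m + 1)).prod 𝓘(ℝ, ℝ)) (liouvilleForm θ) p ![a, b] := by
  rw [← B.symplectic p hp, pullbackOn]
  erw [ContinuousAlternatingMap.compContinuousLinearMap_apply]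
  congr 1
  ext i
  fin_cases i <;> rfl

/-- The contraction of `Ω` with the Liouville direction `∂/∂ρ` is `θ`. -/
theorem form_liouville_apply [IsManifold (𝓡 (2 * m + 1)) ∞ Y] (hθ : SmoothForm (𝓡 (2 * m + 1)) θ) {p : Y × ℝ}
    (hp : p ∈ B.collar.source) (v : TangentSpace (𝓡∂ (2 * m + 2)) (B.collar p)) :
    Ω (B.collar p) ![B.collarDeriv p (0, 1), v] =
      pullback (𝓡∂ (2 * m + 2)) (𝓡 (2 * m + 1)) B.proj θ (B.collar p) ![v] := by
  obtain ⟨b, rfl⟩ := B.collarDeriv_surjective hp v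
  rw [B.form_collarDeriv hp, extD_liouvilleForm_apply hθ, pullback_apply_one,
    B.mfderiv_proj_collarDeriv hp]
  have h : ∀ y : Y, y = p.1 → ∀ e : EuclideanSpace ℝ (Fin (2 * m + 1)),
      θ p.1 ![e] = θ y ![e] := by
    rintro y rfl e
    rfl
  exact h _ (by rw [proj, B.collar.left_inv hp]) b.1

/-- The Hamiltonian vector field of `ρ` is minus the Reeb field. -/
theorem theta_hamVF_rho [IsManifold (𝓡 (2 * m + 1)) ∞ Y] (hΩ : IsSymplectic (𝓡∂ (2 * m + 2)) Ω)
    (hθ : SmoothForm (𝓡 (2 * m + 1)) θ) {w : W} (hw : w ∈ B.collar.target) :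
    pullback (𝓡∂ (2 * m + 2)) (𝓡 (2 * m + 1)) B.proj θ w
      ![hamVF (𝓡∂ (2 * m + 2)) Ω B.rho w] = -1 := by
  obtain ⟨p, hp, rfl⟩ : ∃ p ∈ B.collar.source, B.collar p = w :=
    ⟨_, B.collar.map_target hw, B.collar.right_inv hw⟩
  rw [← B.form_liouville_apply hθ hp, twoForm_swap, hamVF_spec hΩ,
    B.differential_rho_collarDeriv hp]

end ConcaveBoundary

end Collar

section Energy

variable {E : Type*} [NormedAddCommGroup E] [NormedSpace ℝ E]
  {H : Type*} [TopologicalSpace H] {I : ModelWithCorners ℝ E H}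
  {M : Type*} [TopologicalSpace M] [ChartedSpace H M]
  {E' : Type*} [NormedAddCommGroup E'] [NormedSpace ℝ E']
  {H' : Type*} [TopologicalSpace H'] {I' : ModelWithCorners ℝ E' H'}
  {M' : Type*} [TopologicalSpace M'] [ChartedSpace H' M']
  {Ω : DForm I' M' 2} {j : ∀ z : M, TangentSpace I z →L[ℝ] TangentSpace I z}
  {J : M → ∀ w : M', TangentSpace I' w →L[ℝ] TangentSpace I' w} {K : FunForm I M M'}
  {u : M → M'}

theorem SolvesCR.apply_j (hJ : IsCompatibleFamily I I' Ω J) (hCR : SolvesCR I I' Ω j J K u)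
    (z : M) (ξ : TangentSpace I z) :
    mfderiv I I' u z (j z ξ) - XK I I' Ω K z (u z) (j z ξ) =
      J z (u z) (mfderiv I I' u z ξ - XK I I' Ω K z (u z) ξ) := by
  have h := (smul_eq_zero.1 (hCR z ξ)).resolve_left (by norm_num)
  have h1 := congrArg (J z (u z)) h
  rw [map_add, hJ.sq, map_zero, ← sub_eq_add_neg, sub_eq_zero] at h1
  exact h1.symm

/-- The energy density of a solution, in terms of the pullback of the symplectic form. -/
theorem SolvesCR.energy_identity [IsManifold I ∞ M] [IsManifold I' ∞ M']
    [FiniteDimensional ℝ E'] (hΩ : IsSymplectic I' Ω)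
    (hJ : IsCompatibleFamily I I' Ω J) (hK : SmoothFunForm I I' K) {β : DForm I M 1}
    (hβ : SmoothForm I β) (hu : ContMDiff I I' ∞ u) (hCR : SolvesCR I I' Ω j J K u)
    (z : M) (ξ : TangentSpace I z) :
    pullback I I' u Ω z ![ξ, j z ξ] - extD I (fun z => β z - K z (u z)) z ![ξ, j z ξ] =
      Ω (u z) ![mfderiv I I' u z ξ - XK I I' Ω K z (u z) ξ,
        J z (u z) (mfderiv I I' u z ξ - XK I I' Ω K z (u z) ξ)] +
      curvatureTerm I I' Ω K β z (u z) ξ (j z ξ) := by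
  rw [← hCR.apply_j hJ, extD_sub hβ (hK.smoothForm_graph hu), ContinuousAlternatingMap.sub_apply,
    extD_graph_apply hK hu, pullback_apply_two, twoForm_sub_left, twoForm_sub_right,
    twoForm_sub_right, twoForm_swap (Ω (u z)) (mfderiv I I' u z ξ) (XK I I' Ω K z (u z) (j z ξ)),
    curvatureTerm, poisson, XK, XK, hamVF_spec hΩ, hamVF_spec hΩ, hamVF_spec hΩ]
  ring

theorem IsCompatibleFamily.form_nonneg (hJ : IsCompatibleFamily I I' Ω J) (z : M) (w : M')
    (v : TangentSpace I' w) : 0 ≤ Ω w ![v, J z w v] := by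
  by_cases hv : v = 0
  · rw [hv, map_zero, twoForm_self]
  · exact (hJ.pos z w v hv).le

end Energy

section Concave

variable {m : ℕ}
  {W : Type*} [TopologicalSpace W] [ChartedSpace (EuclideanHalfSpace (2 * m + 2)) W]
  {Y : Type*} [TopologicalSpace Y] [ChartedSpace (EuclideanSpace ℝ (Fin (2 * m + 1))) Y]
  {Ω : DForm (𝓡∂ (2 * m + 2)) W 2} {θ : DForm (𝓡 (2 * m + 1)) Y 1} {c : ℝ}
  {S : Type*} [TopologicalSpace S] [ChartedSpace (EuclideanHalfSpace 2) S]
  {K : FunForm (𝓡∂ 2) S W} {α β : DForm (𝓡∂ 2) S 1} {u : S → W}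

namespace ConcaveBoundary

variable (B : ConcaveBoundary Ω θ c)

theorem XK_eq_smul (hΩ : IsSymplectic (𝓡∂ (2 * m + 2)) Ω)
    {w : W} (hw : w ∈ B.collar.target) {z : S}
    (hK : ∀ᶠ w' in 𝓝 w, K z w' = B.rho w' • α z + β z) (ξ : TangentSpace (𝓡∂ 2) z) :
    XK (𝓡∂ 2) (𝓡∂ (2 * m + 2)) Ω K z w ξ =
      α z ![ξ] • hamVF (𝓡∂ (2 * m + 2)) Ω B.rho w := by
  refine hamVF_eq_smul hΩ ?_
  have h1 : (fun w' => K z w' ![ξ]) =ᶠ[𝓝 w] fun w' => α z ![ξ] * B.rho w' + β z ![ξ] := by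
    filter_upwards [hK] with w' hw'
    rw [hw', ContinuousAlternatingMap.add_apply, ContinuousAlternatingMap.smul_apply, smul_eq_mul,
      mul_comm]
  have hr : HasMFDerivAt (𝓡∂ (2 * m + 2)) 𝓘(ℝ, ℝ) B.rho w
      (differential (𝓡∂ (2 * m + 2)) B.rho w) :=
    ((B.contMDiffAt_rho hw).mdifferentiableAt (by simp)).hasMFDerivAt
  have haff : HasFDerivAt (fun t : ℝ => α z ![ξ] * t + β z ![ξ])
      (α z ![ξ] • ContinuousLinearMap.id ℝ ℝ) (B.rho w) :=
    ((hasFDerivAt_id (B.rho w)).const_mul (α z ![ξ])).add_const (β z ![ξ])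
  have h2 := (haff.hasMFDerivAt.comp w hr).congr_of_eventuallyEq h1
  rw [differential, h2.mfderiv]
  rfl

theorem mdifferentiableAt_rho_comp {z : S} (hw : u z ∈ B.collar.target)
    (hu : MDifferentiableAt (𝓡∂ 2) (𝓡∂ (2 * m + 2)) u z) :
    MDifferentiableAt (𝓡∂ 2) 𝓘(ℝ, ℝ) (B.rho ∘ u) z :=
  ((B.contMDiffAt_rho hw).mdifferentiableAt (by simp)).comp z hu

theorem differential_rho_comp {z : S} (hw : u z ∈ B.collar.target)
    (hu : MDifferentiableAt (𝓡∂ 2) (𝓡∂ (2 * m + 2)) u z) (ξ : TangentSpace (𝓡∂ 2) z) :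
    differential (𝓡∂ 2) (B.rho ∘ u) z ξ =
      differential (𝓡∂ (2 * m + 2)) B.rho (u z) (mfderiv (𝓡∂ 2) (𝓡∂ (2 * m + 2)) u z ξ) :=
  DFunLike.congr_fun
    (mfderiv_comp z ((B.contMDiffAt_rho hw).mdifferentiableAt (by simp)) hu) ξ

theorem pullback_proj_comp {z : S} (hw : u z ∈ B.collar.target)
    (hu : MDifferentiableAt (𝓡∂ 2) (𝓡∂ (2 * m + 2)) u z) (ξ : TangentSpace (𝓡∂ 2) z) :
    pullback (𝓡∂ 2) (𝓡 (2 * m + 1)) (B.proj ∘ u) θ z ![ξ] =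
      pullback (𝓡∂ (2 * m + 2)) (𝓡 (2 * m + 1)) B.proj θ (u z)
        ![mfderiv (𝓡∂ 2) (𝓡∂ (2 * m + 2)) u z ξ] := by
  rw [pullback_apply_one, pullback_apply_one,
    mfderiv_comp z ((B.contMDiffAt_proj hw).mdifferentiableAt (by simp)) hu]
  rfl

end ConcaveBoundary

end Concave

theorem oneForm_sub_smul {V : Type*} [AddCommGroup V] [Module ℝ V] [TopologicalSpace V]
    (φ : V [⋀^Fin 1]→L[ℝ] ℝ) (v w : V) (r : ℝ) : φ ![v - r • w] = φ ![v] - r * φ ![w] := by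
  have hadd : φ ![v + (-r) • w] = φ ![v] + φ ![(-r) • w] := φ.map_vecCons_add ![] v ((-r) • w)
  have hsmul : φ ![(-r) • w] = -r * φ ![w] := φ.map_vecCons_smul ![] (-r) w
  rw [sub_eq_add_neg, ← neg_smul, hadd, hsmul]
  ring

section Positivity

variable {m : ℕ}
  {W : Type*} [TopologicalSpace W] [ChartedSpace (EuclideanHalfSpace (2 * m + 2)) W]
  {Y : Type*} [TopologicalSpace Y] [ChartedSpace (EuclideanSpace ℝ (Fin (2 * m + 1))) Y]
  {Ω : DForm (𝓡∂ (2 * m + 2)) W 2} {θ : DForm (𝓡 (2 * m + 1)) Y 1} {c : ℝ}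
  {S : Type*} [TopologicalSpace S] [ChartedSpace (EuclideanHalfSpace 2) S]
  {j : ∀ z : S, TangentSpace (𝓡∂ 2) z →L[ℝ] TangentSpace (𝓡∂ 2) z}
  {J : S → ∀ w : W, TangentSpace (𝓡∂ (2 * m + 2)) w →L[ℝ] TangentSpace (𝓡∂ (2 * m + 2)) w}
  {K : FunForm (𝓡∂ 2) S W} {α β : DForm (𝓡∂ 2) S 1} {u : S → W}

namespace ConcaveBoundary

variable (B : ConcaveBoundary Ω θ c)

theorem eventually_of_nhdsSet_boundary
    (hKαβ : ∀ᶠ w in 𝓝ˢ ((𝓡∂ (2 * m + 2)).boundary W), ∀ z : S, K z w = B.rho w • α z + β z)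
    {w : W} (hw : w ∈ (𝓡∂ (2 * m + 2)).boundary W) :
    ∀ᶠ w' in 𝓝 w, w' ∈ B.collar.target ∧
      ∀ᶠ w'' in 𝓝 w', ∀ z : S, K z w'' = B.rho w'' • α z + β z := by
  have h1 : ∀ᶠ w' in 𝓝 w, ∀ z : S, K z w' = B.rho w' • α z + β z :=
    hKαβ.filter_mono (nhds_le_nhdsSet hw)
  filter_upwards [B.isOpen_target.mem_nhds (B.mem_boundary_iff.1 hw).1,
    eventually_eventually_nhds.2 h1] with w' h2 h3
  exact ⟨h2, h3⟩

/-- Along the boundary of the surface, `c u^*θ ≤ - c α` on positively oriented vectors. -/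
theorem boundary_le [IsManifold (𝓡∂ 2) ∞ S] [IsManifold (𝓡 (2 * m + 1)) ∞ Y]
    (hΩ : IsSymplectic (𝓡∂ (2 * m + 2)) Ω) (hθ : SmoothForm (𝓡 (2 * m + 1)) θ)
    (hJ : IsCompatibleFamily (𝓡∂ 2) (𝓡∂ (2 * m + 2)) Ω J)
    (hKαβ : ∀ᶠ w in 𝓝ˢ ((𝓡∂ (2 * m + 2)).boundary W), ∀ z : S, K z w = B.rho w • α z + β z)
    (hu : ContMDiff (𝓡∂ 2) (𝓡∂ (2 * m + 2)) ∞ u)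
    (hCR : SolvesCR (𝓡∂ 2) (𝓡∂ (2 * m + 2)) Ω j J K u) {z : S}
    (hz : u z ∈ (𝓡∂ (2 * m + 2)).boundary W) (hcontact : B.IsContactType (J z)) {i : S}
    (hi : z ∈ (extChartAt (𝓡∂ 2) i).source) {τ : TangentSpace (𝓡∂ 2) z}
    (hτ : 0 < chartDeriv (𝓡∂ 2) i z (j z τ) 0) :
    pullback (𝓡∂ 2) (𝓡 (2 * m + 1)) (B.proj ∘ u) (fun y => c • θ y) z ![τ] ≤
      (fun z => β z - K z (u z)) z ![τ] := by
  obtain ⟨hw, hrho⟩ := B.mem_boundary_iff.1 hz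
  have hud : MDifferentiableAt (𝓡∂ 2) (𝓡∂ (2 * m + 2)) u z := hu.mdifferentiableAt (by simp)
  have hKz := (B.eventually_of_nhdsSet_boundary hKαβ hz).self_of_nhds.2
  have hX : ∀ ξ, XK (𝓡∂ 2) (𝓡∂ (2 * m + 2)) Ω K z (u z) ξ =
      α z ![ξ] • hamVF (𝓡∂ (2 * m + 2)) Ω B.rho (u z) := fun ξ =>
    B.XK_eq_smul hΩ hw (hKz.mono fun _ h => h z) ξ
  have hct : differential (𝓡∂ (2 * m + 2)) B.rho (u z)
      (J z (u z) (mfderiv (𝓡∂ 2) (𝓡∂ (2 * m + 2)) u z τ -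
        XK (𝓡∂ 2) (𝓡∂ (2 * m + 2)) Ω K z (u z) τ)) =
      -(B.rho (u z) * pullback (𝓡∂ (2 * m + 2)) (𝓡 (2 * m + 1)) B.proj θ (u z)
        ![mfderiv (𝓡∂ 2) (𝓡∂ (2 * m + 2)) u z τ -
          XK (𝓡∂ 2) (𝓡∂ (2 * m + 2)) Ω K z (u z) τ]) :=
    hcontact (u z) hz _
  rw [← hCR.apply_j hJ, hrho, hX, hX, oneForm_sub_smul, map_sub, map_smul,
    differential_hamVF_self hΩ, smul_zero, sub_zero, B.theta_hamVF_rho hΩ hθ hw,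
    ← B.pullback_proj_comp hw hud] at hct
  have hmin : 0 ≤ differential (𝓡∂ 2) (B.rho ∘ u) z (j z τ) := by
    refine differential_nonneg_of_inward hi (B.mdifferentiableAt_rho_comp hw hud) ?_ hτ
    filter_upwards [hu.continuous.continuousAt.preimage_mem_nhds (B.isOpen_target.mem_nhds hw)]
      with z' hz'
    change B.rho (u z) ≤ B.rho (u z')
    rw [hrho]
    exact (B.mem_source_of_mem_target hz').1
  rw [B.differential_rho_comp hw hud] at hmin
  have h1 : pullback (𝓡∂ 2) (𝓡 (2 * m + 1)) (B.proj ∘ u) (fun y => c • θ y) z ![τ] =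
      c * pullback (𝓡∂ 2) (𝓡 (2 * m + 1)) (B.proj ∘ u) θ z ![τ] := rfl
  have h2 : (fun z => β z - K z (u z)) z ![τ] = -(c * α z ![τ]) := by
    change (β z - K z (u z)) ![τ] = _
    rw [hKz.self_of_nhds z, hrho, ContinuousAlternatingMap.sub_apply,
      ContinuousAlternatingMap.add_apply, ContinuousAlternatingMap.smul_apply, smul_eq_mul]
    ring
  rw [h1, h2]
  linarith

variable [IsManifold (𝓡∂ 2) ∞ S]

theorem range_subset_boundary_of_mfderiv_eq [IsManifold (𝓡∂ (2 * m + 2)) ∞ W]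
    (hΩ : IsSymplectic (𝓡∂ (2 * m + 2)) Ω)
    (hS : ∀ z : S, (connectedComponent z ∩ (𝓡∂ 2).boundary S).Nonempty)
    (hKαβ : ∀ᶠ w in 𝓝ˢ ((𝓡∂ (2 * m + 2)).boundary W), ∀ z : S, K z w = B.rho w • α z + β z)
    (hu : ContMDiff (𝓡∂ 2) (𝓡∂ (2 * m + 2)) ∞ u)
    (hu_boundary : ∀ z ∈ (𝓡∂ 2).boundary S, u z ∈ (𝓡∂ (2 * m + 2)).boundary W)
    (hdu : ∀ z ξ, mfderiv (𝓡∂ 2) (𝓡∂ (2 * m + 2)) u z ξ =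
      XK (𝓡∂ 2) (𝓡∂ (2 * m + 2)) Ω K z (u z) ξ) :
    Set.range u ⊆ (𝓡∂ (2 * m + 2)).boundary W := by
  have hclosed : IsClosed (u ⁻¹' (𝓡∂ (2 * m + 2)).boundary W) :=
    ((𝓡∂ (2 * m + 2)).isClosed_boundary (n := ∞) (by simp)).preimage hu.continuous
  have hopen : IsOpen (u ⁻¹' (𝓡∂ (2 * m + 2)).boundary W) := by
    rw [isOpen_iff_mem_nhds]
    intro z hz
    have hev := hu.continuous.continuousAt.eventually (B.eventually_of_nhdsSet_boundary hKαβ hz)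
    have hconst := eventually_eq_of_differential_eq_zero (I := 𝓡∂ 2) (f := B.rho ∘ u) (z := z) (by
      filter_upwards [hev] with z' hz'
      have hud : MDifferentiableAt (𝓡∂ 2) (𝓡∂ (2 * m + 2)) u z' := hu.mdifferentiableAt (by simp)
      refine ⟨B.mdifferentiableAt_rho_comp hz'.1 hud, fun ξ => ?_⟩
      rw [B.differential_rho_comp hz'.1 hud, hdu,
        B.XK_eq_smul hΩ hz'.1 (hz'.2.mono fun _ h => h z') ξ, map_smul,
        differential_hamVF_self hΩ, smul_zero])
    filter_upwards [hconst, hev] with z' h1 h2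
    exact B.mem_boundary_iff.2 ⟨h2.1, h1.trans (B.mem_boundary_iff.1 hz).2⟩
  rintro _ ⟨z, rfl⟩
  obtain ⟨z₁, hz₁, hz₁b⟩ := hS z
  have h1 : connectedComponent z₁ ⊆ u ⁻¹' (𝓡∂ (2 * m + 2)).boundary W :=
    IsClopen.connectedComponent_subset ⟨hclosed, hopen⟩ (hu_boundary z₁ hz₁b)
  rw [← connectedComponent_eq hz₁] at h1
  exact h1 mem_connectedComponent

/-- A map into the boundary pulls back the symplectic form to an exact form. -/
theorem pullback_eq_extD [IsManifold (𝓡 (2 * m + 1)) ∞ Y] (hθ : SmoothForm (𝓡 (2 * m + 1)) θ)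
    (hu : ContMDiff (𝓡∂ 2) (𝓡∂ (2 * m + 2)) ∞ u)
    (hub : Set.range u ⊆ (𝓡∂ (2 * m + 2)).boundary W) :
    pullback (𝓡∂ 2) (𝓡∂ (2 * m + 2)) u Ω = extD (𝓡∂ 2)
      (pullback (𝓡∂ 2) (𝓡 (2 * m + 1)) (B.proj ∘ u) (fun y => c • θ y)) := by
  have hb : ∀ z, u z ∈ B.collar.target ∧ B.rho (u z) = c := fun z =>
    B.mem_boundary_iff.1 (hub ⟨z, rfl⟩)
  set g : S → Y × ℝ := B.collar.symm ∘ u with hg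
  have hgs : ContMDiff (𝓡∂ 2) ((𝓡 (2 * m + 1)).prod 𝓘(ℝ, ℝ)) ∞ g := fun z =>
    (B.contMDiffAt_symm (hb z).1).comp z (hu z)
  have hgsource : ∀ z, g z ∈ B.collar.source := fun z => B.collar.map_target (hb z).1
  have h1 : pullback (𝓡∂ 2) (𝓡 (2 * m + 1)) (B.proj ∘ u) (fun y => c • θ y) =
      pullback (𝓡∂ 2) ((𝓡 (2 * m + 1)).prod 𝓘(ℝ, ℝ)) g (liouvilleForm θ) := by
    funext z
    have hc : (g z).2 = c := (hb z).2
    have hd : mfderiv (𝓡∂ 2) (𝓡 (2 * m + 1)) (B.proj ∘ u) z =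
        mfderiv ((𝓡 (2 * m + 1)).prod 𝓘(ℝ, ℝ)) (𝓡 (2 * m + 1)) (Prod.fst : Y × ℝ → Y) (g z) ∘L
          mfderiv (𝓡∂ 2) ((𝓡 (2 * m + 1)).prod 𝓘(ℝ, ℝ)) g z :=
      mfderiv_comp (g := (Prod.fst : Y × ℝ → Y)) (f := g) z mdifferentiableAt_fst
        (hgs.mdifferentiableAt (by simp))
    ext v
    change c * θ (B.proj (u z)) _ = (g z).2 * θ (g z).1 _
    rw [hc, hd]
    rfl
  have h2 : u = B.collar ∘ g := by
    funext z
    exact (B.collar.right_inv (hb z).1).symm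
  have h3 : pullback (𝓡∂ 2) (𝓡∂ (2 * m + 2)) u Ω =
      pullback (𝓡∂ 2) (𝓡∂ (2 * m + 2)) (B.collar ∘ g) Ω := by
    conv_lhs => rw [h2]
  rw [h1, extD_pullback (liouvilleForm_smooth hθ) hgs, h3]
  funext z
  have hd : mfderiv (𝓡∂ 2) (𝓡∂ (2 * m + 2)) (B.collar ∘ g) z =
      B.collarDeriv (g z) ∘L mfderiv (𝓡∂ 2) ((𝓡 (2 * m + 1)).prod 𝓘(ℝ, ℝ)) g z := by
    have h4 := (B.hasMFDerivWithinAt_collar (hgsource z)).comp z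
      (hgs.mdifferentiableAt (x := z) (by simp)).hasMFDerivAt.hasMFDerivWithinAt
      (s := Set.univ) fun z' _ => hgsource z'
    exact (hasMFDerivWithinAt_univ.1 h4).mfderiv
  rw [pullback, hd, pullback, ← B.symplectic _ (hgsource z)]
  rfl

variable [T2Space S] [CompactSpace S]

/-- The value of the relative class is the integral of a non-negative form plus a boundary
defect. -/
theorem relClass_eq [IsManifold (𝓡∂ (2 * m + 2)) ∞ W]
    (hj : IsComplexStructure (𝓡∂ 2) j) (hΩ : SmoothForm (𝓡∂ (2 * m + 2)) Ω)
    (hK : SmoothFunForm (𝓡∂ 2) (𝓡∂ (2 * m + 2)) K) (hβ : SmoothForm (𝓡∂ 2) β)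
    (hu : ContMDiff (𝓡∂ 2) (𝓡∂ (2 * m + 2)) ∞ u) :
    B.relClass j u = surfaceIntegral j (fun z => pullback (𝓡∂ 2) (𝓡∂ (2 * m + 2)) u Ω z -
        extD (𝓡∂ 2) (fun z => β z - K z (u z)) z) +
      (boundaryIntegral j (fun z => β z - K z (u z)) - boundaryIntegral j
        (pullback (𝓡∂ 2) (𝓡 (2 * m + 1)) (B.proj ∘ u) (fun y => c • θ y))) := by
  have hζ : SmoothForm (𝓡∂ 2) (fun z => β z - K z (u z)) := hβ.sub (hK.smoothForm_graph hu)
  have h1 := surfaceIntegral_add hj ((hΩ.pullback hu).sub hζ.extD) hζ.extD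
  simp only [sub_add_cancel] at h1
  rw [relClass, ← surfaceIntegral_extD hj hζ]
  have h2 : surfaceIntegral j (pullback (𝓡∂ 2) (𝓡∂ (2 * m + 2)) u Ω) = _ := h1
  rw [h2]
  ring

theorem relClass_eq_zero [IsManifold (𝓡 (2 * m + 1)) ∞ Y]
    (hj : IsComplexStructure (𝓡∂ 2) j)
    (hθ : SmoothForm (𝓡 (2 * m + 1)) θ)
    (hu : ContMDiff (𝓡∂ 2) (𝓡∂ (2 * m + 2)) ∞ u)
    (hub : Set.range u ⊆ (𝓡∂ (2 * m + 2)).boundary W) : B.relClass j u = 0 := by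
  have hproj : ContMDiff (𝓡∂ 2) (𝓡 (2 * m + 1)) ∞ (B.proj ∘ u) := fun z =>
    (B.contMDiffAt_proj (B.mem_boundary_iff.1 (hub ⟨z, rfl⟩)).1).comp z (hu z)
  rw [relClass, B.pullback_eq_extD hθ hu hub,
    surfaceIntegral_extD hj ((hθ.const_smul c).pullback hproj), sub_self]

end ConcaveBoundary

end Positivity

end FloerPositivity

end

theorem mainTheorem8
    {m : ℕ}
    -- the symplectic manifold `W` of dimension `2m + 2` and the contact manifold `Y`
    {W : Type*} [TopologicalSpace W] [ChartedSpace (EuclideanHalfSpace (2 * m + 2)) W]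
    [IsManifold (𝓡∂ (2 * m + 2)) ∞ W] [T2Space W] [SecondCountableTopology W]
    {Y : Type*} [TopologicalSpace Y] [ChartedSpace (EuclideanSpace ℝ (Fin (2 * m + 1))) Y]
    [IsManifold (𝓡 (2 * m + 1)) ∞ Y] [T2Space Y] [SecondCountableTopology Y]
    (Ω : FloerPositivity.DForm (𝓡∂ (2 * m + 2)) W 2)
    (hΩ : FloerPositivity.IsSymplectic (𝓡∂ (2 * m + 2)) Ω)
    (θ : FloerPositivity.DForm (𝓡 (2 * m + 1)) Y 1)
    (hθ : FloerPositivity.IsContactForm (𝓡 (2 * m + 1)) θ)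
    (c : ℝ) (B : FloerPositivity.ConcaveBoundary Ω θ c)
    -- the compact Riemann surface `S`, every component of which has boundary
    {S : Type*} [TopologicalSpace S] [ChartedSpace (EuclideanHalfSpace 2) S]
    [IsManifold (𝓡∂ 2) ∞ S] [T2Space S] [CompactSpace S]
    (hS : ∀ z : S, (connectedComponent z ∩ (𝓡∂ 2).boundary S).Nonempty)
    (j : ∀ z : S, TangentSpace (𝓡∂ 2) z →L[ℝ] TangentSpace (𝓡∂ 2) z)
    (hj : FloerPositivity.IsComplexStructure (𝓡∂ 2) j)
    -- the almost complex structures and the Hamiltonian perturbation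
    (J : S → ∀ w : W, TangentSpace (𝓡∂ (2 * m + 2)) w →L[ℝ] TangentSpace (𝓡∂ (2 * m + 2)) w)
    (hJ : FloerPositivity.IsCompatibleFamily (𝓡∂ 2) (𝓡∂ (2 * m + 2)) Ω J)
    (K : FloerPositivity.FunForm (𝓡∂ 2) S W)
    (hK : FloerPositivity.SmoothFunForm (𝓡∂ 2) (𝓡∂ (2 * m + 2)) K)
    -- `J_z` is of contact type along `∂W` for `z ∈ ∂S`
    (hJcontact : ∀ z ∈ (𝓡∂ 2).boundary S, B.IsContactType (J z))
    -- `K = α ρ + β` near `∂W`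
    (α β : FloerPositivity.DForm (𝓡∂ 2) S 1)
    (hα : FloerPositivity.SmoothForm (𝓡∂ 2) α) (hβ : FloerPositivity.SmoothForm (𝓡∂ 2) β)
    (hKαβ : ∀ᶠ w in 𝓝ˢ ((𝓡∂ (2 * m + 2)).boundary W), ∀ z : S, K z w = B.rho w • α z + β z)
    -- `d_S K - {K, K} - dβ ≥ 0`
    (hpos : ∀ (z : S) (ξ : TangentSpace (𝓡∂ 2) z) (w : W),
      0 ≤ FloerPositivity.curvatureTerm (𝓡∂ 2) (𝓡∂ (2 * m + 2)) Ω K β z w ξ (j z ξ))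
    -- the solution `u : (S, ∂S) → (W, ∂W)`
    (u : S → W) (hu : ContMDiff (𝓡∂ 2) (𝓡∂ (2 * m + 2)) ∞ u)
    (hu_boundary : ∀ z ∈ (𝓡∂ 2).boundary S, u z ∈ (𝓡∂ (2 * m + 2)).boundary W)
    (hCR : FloerPositivity.SolvesCR (𝓡∂ 2) (𝓡∂ (2 * m + 2)) Ω j J K u) :
    0 ≤ B.relClass j u ∧
      (B.relClass j u = 0 ↔ Set.range u ⊆ (𝓡∂ (2 * m + 2)).boundary W) := by
  open FloerPositivity in
  have hζ : SmoothForm (𝓡∂ 2) (fun z => β z - K z (u z)) := hβ.sub (hK.smoothForm_graph hu)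
  have hPs := (hΩ.smooth.pullback hu).sub hζ.extD
  have henergy := fun z ξ => hCR.energy_identity hΩ hJ hK hβ hu z ξ
  have hP : ∀ z ξ, 0 ≤ (pullback (𝓡∂ 2) (𝓡∂ (2 * m + 2)) u Ω z -
      extD (𝓡∂ 2) (fun z => β z - K z (u z)) z) ![ξ, j z ξ] := by
    intro z ξ
    rw [ContinuousAlternatingMap.sub_apply, henergy]
    exact add_nonneg (hJ.form_nonneg z (u z) _) (hpos z ξ (u z))
  have hbd : boundaryIntegral j
      (pullback (𝓡∂ 2) (𝓡 (2 * m + 1)) (B.proj ∘ u) (fun y => c • θ y)) ≤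
      boundaryIntegral j (fun z => β z - K z (u z)) := by
    refine boundaryIntegral_mono hj (fun i y hy => ?_)
      (fun i => (hζ i).continuousOn.mono fun y hy => hy.1)
      (fun z hz i hi τ hτ => B.boundary_le hΩ hθ.smooth hJ hKαβ hu hCR (hu_boundary z hz)
        (hJcontact z hz) hi hτ)
    have hU : IsOpen (u ⁻¹' B.collar.target) := B.isOpen_target.preimage hu.continuous
    have hproj : ContMDiffOn (𝓡∂ 2) (𝓡 (2 * m + 1)) ∞ (B.proj ∘ u) (u ⁻¹' B.collar.target) :=
      fun z hz => ((B.contMDiffAt_proj hz).comp z (hu z)).contMDiffWithinAt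
    exact (contDiffWithinAt_formInChart_pullback (hθ.smooth.const_smul c) hU hproj hy.1
      (B.mem_boundary_iff.1 (hu_boundary _ (symm_mem_boundary hy.1 hy.2))).1).continuousWithinAt.mono
        fun y' hy' => extChartAt_target_subset_range i hy'.1
  have hsurf := surfaceIntegral_nonneg hj hP
  have hrel := B.relClass_eq hj hΩ.smooth hK hβ hu
  refine ⟨by rw [hrel]; linarith, fun h0 => ?_, B.relClass_eq_zero hj hθ.smooth hu⟩
  have hzero := eq_zero_of_surfaceIntegral_eq_zero hj hPs hP (by linarith)
  refine B.range_subset_boundary_of_mfderiv_eq hΩ hS hKαβ hu hu_boundary fun z ξ => ?_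
  have h1 := hzero z ξ (j z ξ)
  rw [ContinuousAlternatingMap.sub_apply, henergy] at h1
  have h2 := hJ.form_nonneg z (u z) (mfderiv (𝓡∂ 2) (𝓡∂ (2 * m + 2)) u z ξ -
    XK (𝓡∂ 2) (𝓡∂ (2 * m + 2)) Ω K z (u z) ξ)
  have h3 := hpos z ξ (u z)
  by_contra hne
  have h4 := hJ.pos z (u z) _ (sub_ne_zero.2 hne)
  linarith
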